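/- \textbf{Proposition (classification of Mackey $\underline{\mathbb Z}$-modules).} Let $G$ be a finite group. \emph{Definitions.} The Burnside category $\mathscr B_G$ has the finite $G$-sets as objects. The group of morphisms $T\to U$ is the group completion of the commutative monoid (under disjoint union in $S$) of isomorphism classes of diagrams $T\leftarrow S\to U$ of finite $G$-sets and $G$-maps, and composition is given by pullback. A Mackey functor is an additive functor $M:\mathscr B_G\to \mathrm{Ab}$; Mackey functors and natural transformations form the category $\mathrm{Mackey}_G$. A $G$-map $f:S\to T$ induces a restriction $f^*:M(T)\to M(S)$ (the value of $M$ on the class of $T\xleftarrow{f}S= S$) and a transfer $f_*:M(S)\to M(T)$ (the value of $M$ on the class of $S= S\xrightarrow{f}T$). The box product $M\Box N$ is the left Kan extension of $(S,T)\mapsto M(S)\otimes N(T)$ along the Cartesian product $\times:\mathscr B_G\times\mathscr B_G\to\mathscr B_G$. It makes $\mathrm{Mackey}_G$ a symmetric monoidal category whose unit is the Burnside ring functor $\mathscr A=\mathscr B_G(G/G,-)$. A Green functor is a commutative monoid for $\Box$, and a module over a Green functor is a module over this monoid. The constant Green functor $\underline{\mathbb Z}$ sends a finite $G$-set $S$ to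 the group of $G$-invariant functions $S\to\mathbb Z$; restriction along $f$ is composition with $f$, transfer along $f$ is summation over the fibres of $f$, and the multiplication is given by $(\varphi,\psi)\mapsto\big((s,t)\mapsto\varphi(s)\psi(t)\big)$, with unit the constant function $1$. Thus $\underline{\mathbb Z}(G/H)=\mathbb Z$, and for $f:G/H\to G/K$ the restriction $f^*$ is the identity and the transfer $f_*$ is multiplication by $|K|/|H|$. \emph{Statement.} The category of $\underline{\mathbb Z}$-modules is equivalent to the full subcategory of $\mathrm{Mackey}_G$ on those Mackey functors $M$ such that, for all subgroups $H,K\subseteq G$ and every $G$-map $f:G/H\to G/K$, $$f_*f^*=\frac{|K|}{|H|}\quad\text{on } M(G/K)$$ (whenever such an $f$ exists, $|H|$ divides $|K|$). Moreover, the equivalence can be chosen so that, up to natural isomorphism, it sends a $\underline{\mathbb Z}$-module to its underlying Mackey functor. -/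

import Mathlib

open CategoryTheory MonoidalCategory
open scoped TensorProduct

universe w u

noncomputable section

/-- A finite `G`-set. These are the objects of the Burnside category of `G`. -/
structure Burnside (G : Type u) [Group G] where
  /-- the underlying set -/
  carrier : Type u
  [action : MulAction G carrier]
  [finite : Finite carrier]

namespace Burnside

attribute [instance] Burnside.action Burnside.finite

variable {G : Type u} [Group G]

instance : CoeSort (Burnside G) (Type u) := ⟨Burnside.carrier⟩

/-- A diagram `S ← X → T` of finite `G`-sets and `G`-maps. -/
structure Span (S T : Burnside G) where
  /-- the middle finite `G`-set `X` -/
  apex : Burnside G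
  /-- the left leg `X → S` -/
  l : apex →[G] S
  /-- the right leg `X → T` -/
  r : apex →[G] T

/-- The empty `G`-set. -/
def emptySet (G : Type u) [Group G] : Burnside G where
  carrier := PEmpty
  action := { smul := fun _ x => x, one_smul := fun x => x.elim, mul_smul := fun _ _ x => x.elim }

/-- The one-point `G`-set. -/
def point (G : Type u) [Group G] : Burnside G where
  carrier := PUnit
  action := { smul := fun _ x => x, one_smul := fun _ => rfl, mul_smul := fun _ _ _ => rfl }

/-- The cartesian product of two finite `G`-sets, with the diagonal action. -/
def prod (S T : Burnside G) : Burnside G where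
  carrier := S × T

/-- The disjoint union of two finite `G`-sets. -/
def sum (S T : Burnside G) : Burnside G where
  carrier := S ⊕ T

/-- The orbit `G / H`. -/
def orbit [Finite G] (H : Subgroup G) : Burnside G where
  carrier := G ⧸ H

namespace Span

variable {S T U V S' T' U' : Burnside G}

/-- Two diagrams `S ← X → T` and `S ← Y → T` are isomorphic if there is a bijective `G`-map `X → Y`
compatible with the legs. -/
def Iso (X Y : Span S T) : Prop :=
  ∃ e : X.apex ≃ Y.apex, (∀ (g : G) x, e (g • x) = g • e x) ∧
    (∀ x, Y.l (e x) = X.l x) ∧ ∀ x, Y.r (e x) = X.r x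

instance setoid (S T : Burnside G) : Setoid (Span S T) where
  r := Iso
  iseqv :=
    { refl := fun _ => ⟨Equiv.refl _, fun _ _ => rfl, fun _ => rfl, fun _ => rfl⟩
      symm := by
        rintro X Y ⟨e, h, hl, hr⟩
        refine ⟨e.symm, fun g y => ?_, fun y => ?_, fun y => ?_⟩
        · rw [Equiv.symm_apply_eq, h, Equiv.apply_symm_apply]
        · rw [← hl, Equiv.apply_symm_apply]
        · rw [← hr, Equiv.apply_symm_apply]
      trans := by
        rintro X Y Z ⟨e, h, hl, hr⟩ ⟨e', h', hl', hr'⟩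
        exact ⟨e.trans e', fun g x => by simp [h, h'], fun x => by simp [hl, hl'],
          fun x => by simp [hr, hr']⟩ }

/-- The empty diagram. -/
def empty (S T : Burnside G) : Span S T where
  apex := emptySet G
  l := ⟨fun x => PEmpty.elim x, fun _ x => PEmpty.elim x⟩
  r := ⟨fun x => PEmpty.elim x, fun _ x => PEmpty.elim x⟩

/-- The disjoint union `S ← X ⨿ Y → T` of two diagrams. -/
def coprod (X Y : Span S T) : Span S T where
  apex := X.apex.sum Y.apex
  l := ⟨fun x => Sum.elim X.l Y.l x, by rintro g (x | y); exacts [map_smul X.l g x, map_smul Y.l g y]⟩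
  r := ⟨fun x => Sum.elim X.r Y.r x, by rintro g (x | y); exacts [map_smul X.r g x, map_smul Y.r g y]⟩

/-- The underlying set of the pullback of `X → T ← Y`. -/
abbrev PullbackType (X : Span S T) (Y : Span T U) : Type u :=
  {p : X.apex × Y.apex // X.r p.1 = Y.l p.2}

instance (X : Span S T) (Y : Span T U) : MulAction G (PullbackType X Y) where
  smul g p := ⟨g • p.1, by simp [p.2]⟩
  one_smul p := Subtype.ext (one_smul G p.1)
  mul_smul g h p := Subtype.ext (mul_smul g h p.1)

@[simp] lemma smul_val (X : Span S T) (Y : Span T U) (g : G) (p : PullbackType X Y) :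
    (g • p).1 = g • p.1 := rfl

/-- The composition of `S ← X → T` and `T ← Y → U`, by pullback over `T`. -/
def comp (X : Span S T) (Y : Span T U) : Span S U where
  apex := { carrier := PullbackType X Y }
  l := ⟨fun p => X.l p.1.1, fun _ _ => by simp⟩
  r := ⟨fun p => Y.r p.1.2, fun _ _ => by simp⟩

/-- The product `S × S' ← X × X' → T × T'` of `S ← X → T` and `S' ← X' → T'`. -/
def prod (X : Span S T) (X' : Span S' T') : Span (S.prod S') (T.prod T') where
  apex := X.apex.prod X'.apex
  l := ⟨fun p => (X.l p.1, X'.l p.2), fun g _ => Prod.ext (map_smul X.l g _) (map_smul X'.l g _)⟩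
  r := ⟨fun p => (X.r p.1, X'.r p.2), fun g _ => Prod.ext (map_smul X.r g _) (map_smul X'.r g _)⟩

/-- The diagram `S = S → T` of a `G`-map `S → T`. -/
def push (f : S →[G] T) : Span S T := ⟨S, MulActionHom.id G, f⟩

/-- The diagram `T ← S = S` of a `G`-map `S → T`. -/
def pull (f : S →[G] T) : Span T S := ⟨S, f, MulActionHom.id G⟩

section IsoLemmas

lemma coprod_congr {X X' Y Y' : Span S T} (h : Iso X X') (k : Iso Y Y') :
    Iso (coprod X Y) (coprod X' Y') := by
  obtain ⟨e, he, hl, hr⟩ := h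
  obtain ⟨e', he', hl', hr'⟩ := k
  refine ⟨Equiv.sumCongr e e', ?_, ?_, ?_⟩
  · rintro g (x | x)
    exacts [congrArg Sum.inl (he g x), congrArg Sum.inr (he' g x)]
  · rintro (x | x)
    exacts [hl x, hl' x]
  · rintro (x | x)
    exacts [hr x, hr' x]

lemma comp_congr {X X' : Span S T} {Y Y' : Span T U} (h : Iso X X') (k : Iso Y Y') :
    Iso (comp X Y) (comp X' Y') := by
  obtain ⟨e, he, hl, hr⟩ := h
  obtain ⟨e', he', hl', hr'⟩ := k
  refine ⟨(Equiv.prodCongr e e').subtypeEquiv fun p => ?_, ?_, ?_, ?_⟩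
  · simp [hr, hl']
  · rintro g ⟨x, h⟩
    exact Subtype.ext (Prod.ext (he g x.1) (he' g x.2))
  · rintro ⟨x, h⟩
    exact hl x.1
  · rintro ⟨x, h⟩
    exact hr' x.2

lemma prod_congr {X X' : Span S T} {Y Y' : Span S' T'} (h : Iso X X') (k : Iso Y Y') :
    Iso (prod X Y) (prod X' Y') := by
  obtain ⟨e, he, hl, hr⟩ := h
  obtain ⟨e', he', hl', hr'⟩ := k
  refine ⟨Equiv.prodCongr e e', ?_, ?_, ?_⟩
  · rintro g x
    exact Prod.ext (he g x.1) (he' g x.2)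
  · rintro x
    exact Prod.ext (hl x.1) (hl' x.2)
  · rintro x
    exact Prod.ext (hr x.1) (hr' x.2)

lemma coprod_comm (X Y : Span S T) : Iso (coprod X Y) (coprod Y X) :=
  ⟨Equiv.sumComm _ _, by rintro g (x | x) <;> rfl, by rintro (x | x) <;> rfl,
    by rintro (x | x) <;> rfl⟩

lemma coprod_assoc (X Y Z : Span S T) :
    Iso (coprod (coprod X Y) Z) (coprod X (coprod Y Z)) :=
  ⟨Equiv.sumAssoc _ _ _, by rintro g ((x | x) | x) <;> rfl, by rintro ((x | x) | x) <;> rfl,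
    by rintro ((x | x) | x) <;> rfl⟩

lemma empty_coprod (X : Span S T) : Iso (coprod (empty S T) X) X :=
  ⟨Equiv.emptySum PEmpty _, by rintro g (x | x); exacts [PEmpty.elim x, rfl],
    by rintro (x | x); exacts [PEmpty.elim x, rfl], by rintro (x | x); exacts [PEmpty.elim x, rfl]⟩

lemma comp_coprod (X : Span S T) (Y Z : Span T U) :
    Iso (comp X (coprod Y Z)) (coprod (comp X Y) (comp X Z)) := by
  refine ⟨⟨fun p => match p with
      | ⟨(x, Sum.inl y), h⟩ => Sum.inl ⟨(x, y), h⟩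
      | ⟨(x, Sum.inr y), h⟩ => Sum.inr ⟨(x, y), h⟩,
    fun p => match p with
      | Sum.inl p => ⟨(p.1.1, Sum.inl p.1.2), p.2⟩
      | Sum.inr p => ⟨(p.1.1, Sum.inr p.1.2), p.2⟩, ?_, ?_⟩, ?_, ?_, ?_⟩
  · rintro ⟨⟨x, y | y⟩, h⟩ <;> rfl
  · rintro (⟨⟨x, y⟩, h⟩ | ⟨⟨x, y⟩, h⟩) <;> rfl
  · rintro g ⟨⟨x, y | y⟩, h⟩ <;> rfl
  · rintro ⟨⟨x, y | y⟩, h⟩ <;> rfl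
  · rintro ⟨⟨x, y | y⟩, h⟩ <;> rfl

lemma coprod_comp (X Y : Span S T) (Z : Span T U) :
    Iso (comp (coprod X Y) Z) (coprod (comp X Z) (comp Y Z)) := by
  refine ⟨⟨fun p => match p with
      | ⟨(Sum.inl x, y), h⟩ => Sum.inl ⟨(x, y), h⟩
      | ⟨(Sum.inr x, y), h⟩ => Sum.inr ⟨(x, y), h⟩,
    fun p => match p with
      | Sum.inl p => ⟨(Sum.inl p.1.1, p.1.2), p.2⟩
      | Sum.inr p => ⟨(Sum.inr p.1.1, p.1.2), p.2⟩, ?_, ?_⟩, ?_, ?_, ?_⟩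
  · rintro ⟨⟨x | x, y⟩, h⟩ <;> rfl
  · rintro (⟨⟨x, y⟩, h⟩ | ⟨⟨x, y⟩, h⟩) <;> rfl
  · rintro g ⟨⟨x | x, y⟩, h⟩ <;> rfl
  · rintro ⟨⟨x | x, y⟩, h⟩ <;> rfl
  · rintro ⟨⟨x | x, y⟩, h⟩ <;> rfl

lemma prod_coprod (X : Span S T) (Y Z : Span S' T') :
    Iso (prod X (coprod Y Z)) (coprod (prod X Y) (prod X Z)) :=
  ⟨Equiv.prodSumDistrib _ _ _, by rintro g ⟨x, y | y⟩ <;> rfl, by rintro ⟨x, y | y⟩ <;> rfl,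
    by rintro ⟨x, y | y⟩ <;> rfl⟩

lemma coprod_prod (X Y : Span S T) (Z : Span S' T') :
    Iso (prod (coprod X Y) Z) (coprod (prod X Z) (prod Y Z)) :=
  ⟨Equiv.sumProdDistrib _ _ _, by rintro g ⟨x | x, y⟩ <;> rfl, by rintro ⟨x | x, y⟩ <;> rfl,
    by rintro ⟨x | x, y⟩ <;> rfl⟩

lemma comp_assoc (X : Span S T) (Y : Span T U) (Z : Span U V) :
    Iso (comp (comp X Y) Z) (comp X (comp Y Z)) :=
  ⟨⟨fun p => ⟨(p.1.1.1.1, ⟨(p.1.1.1.2, p.1.2), p.2⟩), p.1.1.2⟩,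
    fun p => ⟨(⟨(p.1.1, p.1.2.1.1), p.2⟩, p.1.2.1.2), p.1.2.2⟩, fun _ => rfl, fun _ => rfl⟩,
    fun _ _ => rfl, fun _ => rfl, fun _ => rfl⟩

lemma comp_push (X : Span S T) (f : T →[G] U) : Iso (comp X (push f)) ⟨X.apex, X.l, f.comp X.r⟩ :=
  ⟨⟨fun p => p.1.1, fun x => ⟨(x, X.r x), rfl⟩,
    fun p => Subtype.ext (Prod.ext rfl p.2), fun _ => rfl⟩,
    fun _ _ => rfl, fun _ => rfl, fun p => congrArg f p.2⟩

lemma pull_comp (f : T →[G] S) (X : Span T U) : Iso (comp (pull f) X) ⟨X.apex, f.comp X.l, X.r⟩ :=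
  ⟨⟨fun p => p.1.2, fun x => ⟨(X.l x, x), rfl⟩,
    fun p => Subtype.ext (Prod.ext p.2.symm rfl), fun _ => rfl⟩,
    fun _ _ => rfl, fun p => congrArg f p.2.symm, fun _ => rfl⟩

lemma prod_comp (X : Span S T) (Y : Span T U) (X' : Span S' T') (Y' : Span T' U') :
    Iso (prod (comp X Y) (comp X' Y')) (comp (prod X X') (prod Y Y')) :=
  ⟨⟨fun p => ⟨((p.1.1.1, p.2.1.1), (p.1.1.2, p.2.1.2)), Prod.ext p.1.2 p.2.2⟩,
    fun p => (⟨(p.1.1.1, p.1.2.1), congrArg Prod.fst p.2⟩,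
      ⟨(p.1.1.2, p.1.2.2), congrArg Prod.snd p.2⟩), fun _ => rfl, fun _ => rfl⟩,
    fun _ _ => rfl, fun _ => rfl, fun _ => rfl⟩

lemma push_iso_pull (f : S →[G] T) (g : T →[G] S) (h₁ : ∀ s, g (f s) = s) (h₂ : ∀ t, f (g t) = t) :
    Iso (push f) (pull g) :=
  ⟨⟨f, g, h₁, h₂⟩, fun c x => map_smul f c x, h₁, fun _ => rfl⟩

end IsoLemmas

end Span

/-! ### Morphisms of the Burnside category -/

variable {S T U V S' T' U' : Burnside G}

/-- Isomorphism classes of diagrams `S ← X → T`. -/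
abbrev SpanClass (S T : Burnside G) : Type (u + 1) := Quotient (Span.setoid S T)

/-- Addition of isomorphism classes of diagrams is disjoint union. -/
instance (S T : Burnside G) : Add (SpanClass S T) where
  add := Quotient.map₂ Span.coprod fun _ _ h _ _ k => Span.coprod_congr h k

instance (S T : Burnside G) : Zero (SpanClass S T) := ⟨⟦Span.empty S T⟧⟩

instance (S T : Burnside G) : AddCommMonoid (SpanClass S T) where
  add_assoc := by rintro ⟨X⟩ ⟨Y⟩ ⟨Z⟩; exact Quotient.sound (Span.coprod_assoc X Y Z)
  add_comm := by rintro ⟨X⟩ ⟨Y⟩; exact Quotient.sound (Span.coprod_comm X Y)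
  zero_add := by rintro ⟨X⟩; exact Quotient.sound (Span.empty_coprod X)
  add_zero := by
    rintro ⟨X⟩
    exact Quotient.sound
      ((Span.setoid S T).iseqv.trans (Span.coprod_comm X _) (Span.empty_coprod X))
  nsmul := nsmulRec

lemma mk_add_mk (X Y : Span S T) : (⟦X⟧ + ⟦Y⟧ : SpanClass S T) = ⟦X.coprod Y⟧ := rfl

/-- The morphisms from `S` to `T` in the Burnside category: the group completion of the monoid of
isomorphism classes of diagrams `S ← X → T`. -/
def Mor (S T : Burnside G) : Type (u + 1) := Algebra.GrothendieckAddGroup (SpanClass S T)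

instance (S T : Burnside G) : AddCommGroup (Mor S T) :=
  inferInstanceAs (AddCommGroup (Algebra.GrothendieckAddGroup (SpanClass S T)))

/-- The canonical map from isomorphism classes of diagrams to the group completion. -/
def Mor.of (S T : Burnside G) : SpanClass S T →+ Mor S T := Algebra.GrothendieckAddGroup.of

/-- The morphism represented by a diagram. -/
def ofSpan (X : Span S T) : Mor S T := Mor.of S T ⟦X⟧

lemma ofSpan_eq {X Y : Span S T} (h : Span.Iso X Y) : ofSpan X = ofSpan Y :=
  congrArg (Mor.of S T) (Quotient.sound h)

lemma ofSpan_coprod (X Y : Span S T) : ofSpan (X.coprod Y) = ofSpan X + ofSpan Y :=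
  map_add (Mor.of S T) ⟦X⟧ ⟦Y⟧

lemma ofSpan_empty : ofSpan (Span.empty S T) = 0 :=
  map_zero (Mor.of S T)

lemma Mor.exists_sub (a : Mor S T) : ∃ x y, a = Mor.of S T x - Mor.of S T y := by
  induction a using AddLocalization.ind with
  | H y =>
    obtain ⟨x, ⟨y, hy⟩⟩ := y
    have key : (AddLocalization.mk x ⟨y, hy⟩ : Algebra.GrothendieckAddGroup (SpanClass S T)) =
        (AddLocalization.addMonoidOf ⊤ x - AddLocalization.addMonoidOf ⊤ y :
          Algebra.GrothendieckAddGroup (SpanClass S T)) := by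
      rw [← AddLocalization.mk_zero_eq_addMonoidOf_mk, ← AddLocalization.mk_zero_eq_addMonoidOf_mk,
        Algebra.GrothendieckAddGroup.mk_sub_mk]
      simp
    exact ⟨x, y, key⟩

lemma Mor.induction {p : Mor S T → Prop} (of : ∀ X, p (ofSpan X))
    (sub : ∀ a b, p a → p b → p (a - b)) (a : Mor S T) : p a := by
  obtain ⟨⟨X⟩, ⟨Y⟩, rfl⟩ := Mor.exists_sub a
  exact sub _ _ (of X) (of Y)

lemma Mor.hom_ext {A : Type*} [AddGroup A] {f g : Mor S T →+ A}
    (h : ∀ X, f (ofSpan X) = g (ofSpan X)) : f = g := by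
  ext a
  induction a using Mor.induction with
  | of X => exact h X
  | sub a b ha hb => simp only [map_sub, ha, hb]

/-- An additive function on diagrams extends to the group completion. -/
def Mor.lift {A : Type*} [AddCommGroup A] (f : Span S T → A)
    (h : ∀ X Y, Span.Iso X Y → f X = f Y) (h₀ : f (Span.empty S T) = 0)
    (hadd : ∀ X Y, f (X.coprod Y) = f X + f Y) : Mor S T →+ A :=
  Algebra.GrothendieckAddGroup.lift
    { toFun := Quotient.lift f h
      map_zero' := h₀
      map_add' := by rintro ⟨X⟩ ⟨Y⟩; exact hadd X Y }

@[simp] lemma Mor.lift_ofSpan {A : Type*} [AddCommGroup A] (f : Span S T → A)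
    (h : ∀ X Y, Span.Iso X Y → f X = f Y) (h₀ : f (Span.empty S T) = 0)
    (hadd : ∀ X Y, f (X.coprod Y) = f X + f Y) (X : Span S T) :
    Mor.lift f h h₀ hadd (ofSpan X) = f X :=
  DFunLike.congr_fun (Algebra.GrothendieckAddGroup.lift.symm_apply_apply
    ({ toFun := Quotient.lift f h
       map_zero' := h₀
       map_add' := by rintro ⟨X⟩ ⟨Y⟩; exact hadd X Y } : SpanClass S T →+ A)) ⟦X⟧

lemma eq_zero_of_eq_add_self {A : Type*} [AddGroup A] {a : A} (h : a = a + a) : a = 0 := by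
  simpa using h

/-- The biadditive extension of a biadditive operation on diagrams. -/
def Mor.lift₂ {A : Type*} [AddCommGroup A] (f : Span S T → Span S' T' → A)
    (h : ∀ X X' Y Y', Span.Iso X X' → Span.Iso Y Y' → f X Y = f X' Y')
    (hl : ∀ X X' Y, f (X.coprod X') Y = f X Y + f X' Y)
    (hr : ∀ X Y Y', f X (Y.coprod Y') = f X Y + f X Y') : Mor S T →+ Mor S' T' →+ A :=
  Mor.lift
    (fun X => Mor.lift (f X) (fun Y Y' k => h _ _ _ _ ((Span.setoid S T).refl X) k)
      (eq_zero_of_eq_add_self (by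
        rw [← hr]
        exact h _ _ _ _ ((Span.setoid S T).refl X)
          ((Span.setoid S' T').symm (Span.empty_coprod _))))
      (hr X))
    (fun X X' k => Mor.hom_ext fun Y => by
      simpa using h _ _ _ _ k ((Span.setoid S' T').refl Y))
    (Mor.hom_ext fun Y => by
      simpa using eq_zero_of_eq_add_self (by
        rw [← hl]
        exact h _ _ _ _ ((Span.setoid S T).symm (Span.empty_coprod _))
          ((Span.setoid S' T').refl Y)))
    (fun X X' => Mor.hom_ext fun Y => by simpa using hl X X' Y)

@[simp] lemma Mor.lift₂_ofSpan {A : Type*} [AddCommGroup A] (f : Span S T → Span S' T' → A)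
    (h : ∀ X X' Y Y', Span.Iso X X' → Span.Iso Y Y' → f X Y = f X' Y')
    (hl : ∀ X X' Y, f (X.coprod X') Y = f X Y + f X' Y)
    (hr : ∀ X Y Y', f X (Y.coprod Y') = f X Y + f X Y') (X : Span S T) (Y : Span S' T') :
    Mor.lift₂ f h hl hr (ofSpan X) (ofSpan Y) = f X Y := by
  simp [Mor.lift₂]

/-- Composition of morphisms: the biadditive extension of the pullback of diagrams. -/
def compHom (S T U : Burnside G) : Mor S T →+ Mor T U →+ Mor S U :=
  Mor.lift₂ (fun X Y => ofSpan (X.comp Y))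
    (fun _ _ _ _ h k => ofSpan_eq (Span.comp_congr h k))
    (fun X X' Y => (ofSpan_eq (Span.coprod_comp X X' Y)).trans (ofSpan_coprod _ _))
    (fun X Y Y' => (ofSpan_eq (Span.comp_coprod X Y Y')).trans (ofSpan_coprod _ _))

/-- The product of morphisms: the biadditive extension of the product of diagrams. -/
def prodHom (S T S' T' : Burnside G) : Mor S T →+ Mor S' T' →+ Mor (S.prod S') (T.prod T') :=
  Mor.lift₂ (fun X Y => ofSpan (X.prod Y))
    (fun _ _ _ _ h k => ofSpan_eq (Span.prod_congr h k))
    (fun X X' Y => (ofSpan_eq (Span.coprod_prod X X' Y)).trans (ofSpan_coprod _ _))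
    (fun X Y Y' => (ofSpan_eq (Span.prod_coprod X Y Y')).trans (ofSpan_coprod _ _))

lemma compHom_ofSpan (X : Span S T) (Y : Span T U) :
    compHom S T U (ofSpan X) (ofSpan Y) = ofSpan (X.comp Y) := Mor.lift₂_ofSpan ..

lemma prodHom_ofSpan (X : Span S T) (Y : Span S' T') :
    prodHom S T S' T' (ofSpan X) (ofSpan Y) = ofSpan (X.prod Y) := Mor.lift₂_ofSpan ..

/-- The Burnside category. -/
instance : Category (Burnside G) where
  Hom S T := Mor S T
  id S := ofSpan (Span.push (MulActionHom.id G))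
  comp {S T U} a b := compHom S T U a b
  id_comp {S T} a := by
    induction a using Mor.induction with
    | of X =>
      rw [compHom_ofSpan]
      exact ofSpan_eq (Span.pull_comp (MulActionHom.id G) X)
    | sub a b ha hb => rw [map_sub, ha, hb]
  comp_id {S T} a := by
    induction a using Mor.induction with
    | of X =>
      rw [compHom_ofSpan]
      exact ofSpan_eq (Span.comp_push X (MulActionHom.id G))
    | sub a b ha hb => rw [map_sub, AddMonoidHom.sub_apply, ha, hb]
  assoc {S T U V} a b c := by
    induction a using Mor.induction with
    | sub a a' ha ha' => simp only [map_sub, AddMonoidHom.sub_apply, ha, ha']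
    | of X =>
      induction b using Mor.induction with
      | sub b b' hb hb' => simp only [map_sub, AddMonoidHom.sub_apply, hb, hb']
      | of Y =>
        induction c using Mor.induction with
        | sub c c' hc hc' => simp only [map_sub, hc, hc']
        | of Z =>
          simp only [compHom_ofSpan]
          exact ofSpan_eq (Span.comp_assoc X Y Z)

instance (S T : Burnside G) : AddCommGroup (S ⟶ T) := inferInstanceAs (AddCommGroup (Mor S T))

instance : Preadditive (Burnside G) where
  add_comp S T U a a' b := by
    change compHom S T U (a + a') b = compHom S T U a b + compHom S T U a' b
    rw [map_add, AddMonoidHom.add_apply]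
  comp_add S T U a b b' := by
    change compHom S T U a (b + b') = compHom S T U a b + compHom S T U a b'
    rw [map_add]

/-- The morphism of the Burnside category represented by a diagram. -/
def homOf (X : Span S T) : S ⟶ T := ofSpan X

lemma homOf_eq {X Y : Span S T} (h : Span.Iso X Y) : homOf X = homOf Y := ofSpan_eq h

lemma homOf_comp (X : Span S T) (Y : Span T U) : homOf X ≫ homOf Y = homOf (X.comp Y) :=
  compHom_ofSpan X Y

lemma hom_induction {p : (S ⟶ T) → Prop} (of : ∀ X, p (homOf X))
    (sub : ∀ a b : S ⟶ T, p a → p b → p (a - b)) (a : S ⟶ T) : p a :=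
  Mor.induction of sub a

/-- The covariant (transfer) morphism `S ⟶ T` given by a `G`-map `S → T`. -/
def push (f : S →[G] T) : S ⟶ T := homOf (Span.push f)

/-- The contravariant (restriction) morphism `T ⟶ S` given by a `G`-map `S → T`. -/
def pull (f : S →[G] T) : T ⟶ S := homOf (Span.pull f)

lemma homOf_comp_push (X : Span S T) (f : T →[G] U) :
    homOf X ≫ push f = homOf ⟨X.apex, X.l, f.comp X.r⟩ :=
  (homOf_comp _ _).trans (homOf_eq (Span.comp_push X f))

lemma pull_comp_homOf (f : T →[G] S) (X : Span T U) :
    pull f ≫ homOf X = homOf ⟨X.apex, f.comp X.l, X.r⟩ :=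
  (homOf_comp _ _).trans (homOf_eq (Span.pull_comp f X))

lemma push_comp (f : S →[G] T) (g : T →[G] U) : push f ≫ push g = push (g.comp f) :=
  homOf_comp_push (Span.push f) g

lemma push_id (S : Burnside G) : push (MulActionHom.id G) = 𝟙 S := rfl

lemma pull_id (S : Burnside G) : pull (MulActionHom.id G) = 𝟙 S := rfl

lemma pull_comp (f : S →[G] T) (g : T →[G] U) : pull g ≫ pull f = pull (g.comp f) :=
  pull_comp_homOf g (Span.pull f)

lemma push_eq_pull (f : S →[G] T) (g : T →[G] S) (h₁ : ∀ s, g (f s) = s) (h₂ : ∀ t, f (g t) = t) :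
    push f = pull g :=
  homOf_eq (Span.push_iso_pull f g h₁ h₂)

/-- Mutually inverse `G`-maps give an isomorphism in the Burnside category. -/
@[simps] def isoOf (f : S →[G] T) (g : T →[G] S) (h₁ : ∀ s, g (f s) = s) (h₂ : ∀ t, f (g t) = t) :
    S ≅ T where
  hom := push f
  inv := push g
  hom_inv_id := by rw [push_comp, ← push_id]; congr 1; ext s; exact h₁ s
  inv_hom_id := by rw [push_comp, ← push_id]; congr 1; ext s; exact h₂ s

/-- The product of two morphisms of the Burnside category. -/
def prodMap (a : S ⟶ T) (b : S' ⟶ T') : S.prod S' ⟶ T.prod T' := prodHom S T S' T' a b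

lemma prodMap_add_left (a a' : S ⟶ T) (b : S' ⟶ T') :
    prodMap (a + a') b = prodMap a b + prodMap a' b := by
  change prodHom S T S' T' (a + a') b = prodHom S T S' T' a b + prodHom S T S' T' a' b
  rw [map_add, AddMonoidHom.add_apply]

lemma prodMap_add_right (a : S ⟶ T) (b b' : S' ⟶ T') :
    prodMap a (b + b') = prodMap a b + prodMap a b' := by
  change prodHom S T S' T' a (b + b') = prodHom S T S' T' a b + prodHom S T S' T' a b'
  rw [map_add]

lemma prodMap_sub_left (a a' : S ⟶ T) (b : S' ⟶ T') :
    prodMap (a - a') b = prodMap a b - prodMap a' b := by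
  change prodHom S T S' T' (a - a') b = prodHom S T S' T' a b - prodHom S T S' T' a' b
  rw [map_sub, AddMonoidHom.sub_apply]

lemma prodMap_sub_right (a : S ⟶ T) (b b' : S' ⟶ T') :
    prodMap a (b - b') = prodMap a b - prodMap a b' := by
  change prodHom S T S' T' a (b - b') = prodHom S T S' T' a b - prodHom S T S' T' a b'
  rw [map_sub]

lemma prodMap_homOf (X : Span S T) (Y : Span S' T') :
    prodMap (homOf X) (homOf Y) = homOf (X.prod Y) := prodHom_ofSpan X Y

/-- The product of two `G`-maps. -/
def mapProd (f : S →[G] T) (g : S' →[G] T') : S.prod S' →[G] T.prod T' :=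
  ⟨fun p => (f p.1, g p.2), fun c _ => Prod.ext (map_smul f c _) (map_smul g c _)⟩

/-- The `G`-map `((s, t), u) ↦ (s, (t, u))`. -/
def assocMap (S T U : Burnside G) : (S.prod T).prod U →[G] S.prod (T.prod U) :=
  ⟨Equiv.prodAssoc S T U, fun _ _ => rfl⟩

/-- The `G`-map `(s, (t, u)) ↦ ((s, t), u)`. -/
def assocInvMap (S T U : Burnside G) : S.prod (T.prod U) →[G] (S.prod T).prod U :=
  ⟨(Equiv.prodAssoc S T U).symm, fun _ _ => rfl⟩

/-- The `G`-map `(s, t) ↦ t`. -/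
def sndMap (S T : Burnside G) : S.prod T →[G] T := ⟨Prod.snd, fun _ _ => rfl⟩

/-- The `G`-map `(s, t) ↦ s`. -/
def fstMap (S T : Burnside G) : S.prod T →[G] S := ⟨Prod.fst, fun _ _ => rfl⟩

/-- The `G`-map `s ↦ (pt, s)`. -/
def pointPairMap (S : Burnside G) : S →[G] (point G).prod S :=
  ⟨fun s => (PUnit.unit, s), fun _ _ => rfl⟩

/-- The `G`-map `s ↦ (s, pt)`. -/
def pairPointMap (S : Burnside G) : S →[G] S.prod (point G) :=
  ⟨fun s => (s, PUnit.unit), fun _ _ => rfl⟩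

/-- The `G`-map `(s, t) ↦ (t, s)`. -/
def swapMap (S T : Burnside G) : S.prod T →[G] T.prod S := ⟨Prod.swap, fun _ _ => rfl⟩

lemma prodMap_push (f : S →[G] T) (g : S' →[G] T') :
    prodMap (push f) (push g) = push (mapProd f g) :=
  prodMap_homOf _ _

lemma prodMap_comp (a : S ⟶ T) (b : T ⟶ U) (a' : S' ⟶ T') (b' : T' ⟶ U') :
    prodMap a a' ≫ prodMap b b' = prodMap (a ≫ b) (a' ≫ b') := by
  induction a using hom_induction with
  | sub a₁ a₂ h₁ h₂ => simp only [prodMap_sub_left, Preadditive.sub_comp, h₁, h₂]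
  | of X =>
    induction b using hom_induction with
    | sub a₁ a₂ h₁ h₂ => simp only [prodMap_sub_left, Preadditive.comp_sub, h₁, h₂]
    | of Y =>
      induction a' using hom_induction with
      | sub a₁ a₂ h₁ h₂ => simp only [prodMap_sub_right, Preadditive.sub_comp, h₁, h₂]
      | of X' =>
        induction b' using hom_induction with
        | sub a₁ a₂ h₁ h₂ => simp only [prodMap_sub_right, Preadditive.comp_sub, h₁, h₂]
        | of Y' =>
          simp only [prodMap_homOf, homOf_comp]
          exact (homOf_eq (Span.prod_comp X Y X' Y')).symm

/-- The associativity isomorphism of the product. -/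
def assocIso (S T U : Burnside G) : (S.prod T).prod U ≅ S.prod (T.prod U) :=
  isoOf (assocMap S T U) (assocInvMap S T U) (fun _ => rfl) (fun _ => rfl)

/-- The left unit isomorphism of the product. -/
def leftUnitIso (S : Burnside G) : (point G).prod S ≅ S :=
  isoOf (sndMap _ S) (pointPairMap S) (fun _ => rfl) (fun _ => rfl)

/-- The right unit isomorphism of the product. -/
def rightUnitIso (S : Burnside G) : S.prod (point G) ≅ S :=
  isoOf (fstMap S _) (pairPointMap S) (fun _ => rfl) (fun _ => rfl)

/-- The symmetry isomorphism of the product. -/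
def swapIso (S T : Burnside G) : S.prod T ≅ T.prod S :=
  isoOf (swapMap S T) (swapMap T S) (fun _ => rfl) (fun _ => rfl)

instance : MonoidalCategoryStruct (Burnside G) where
  tensorObj S T := S.prod T
  tensorHom a b := prodMap a b
  whiskerLeft S _ _ b := prodMap (𝟙 S) b
  whiskerRight a S := prodMap a (𝟙 S)
  tensorUnit := point G
  associator := assocIso
  leftUnitor := leftUnitIso
  rightUnitor := rightUnitIso

lemma assoc_hom_eq_pull : (assocIso S T U).hom =
    pull (assocInvMap S T U) :=
  push_eq_pull _ _ (fun _ => rfl) (fun _ => rfl)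

lemma leftUnit_hom_eq_pull : (leftUnitIso S).hom =
    pull (pointPairMap S) :=
  push_eq_pull _ _ (fun _ => rfl) (fun _ => rfl)

lemma rightUnit_hom_eq_pull : (rightUnitIso S).hom =
    pull (pairPointMap S) :=
  push_eq_pull _ _ (fun _ => rfl) (fun _ => rfl)

lemma swap_hom_eq_pull : (swapIso S T).hom =
    pull (swapMap T S) :=
  push_eq_pull _ _ (fun _ => rfl) (fun _ => rfl)

lemma assoc_naturality (a : S ⟶ S') (b : T ⟶ T') (c : U ⟶ U') :
    prodMap (prodMap a b) c ≫ (assocIso S' T' U').hom =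
      (assocIso S T U).hom ≫ prodMap a (prodMap b c) := by
  induction a using hom_induction with
  | sub a₁ a₂ h₁ h₂ => simp only [prodMap_sub_left, Preadditive.sub_comp, Preadditive.comp_sub, h₁, h₂]
  | of X =>
    induction b using hom_induction with
    | sub a₁ a₂ h₁ h₂ => simp only [prodMap_sub_left, prodMap_sub_right, Preadditive.sub_comp,
        Preadditive.comp_sub, h₁, h₂]
    | of Y =>
      induction c using hom_induction with
      | sub a₁ a₂ h₁ h₂ => simp only [prodMap_sub_right, Preadditive.sub_comp,
          Preadditive.comp_sub, h₁, h₂]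
      | of Z =>
        rw [assoc_hom_eq_pull (S := S), prodMap_homOf, prodMap_homOf, prodMap_homOf, prodMap_homOf,
          pull_comp_homOf]
        refine (homOf_comp_push _ _).trans (homOf_eq ?_)
        exact ⟨Equiv.prodAssoc _ _ _, fun _ _ => rfl, fun _ => rfl, fun _ => rfl⟩

lemma leftUnit_naturality (a : S ⟶ T) :
    prodMap (𝟙 (point G)) a ≫ (leftUnitIso T).hom = (leftUnitIso S).hom ≫ a := by
  induction a using hom_induction with
  | sub a₁ a₂ h₁ h₂ => simp only [prodMap_sub_right, Preadditive.sub_comp, Preadditive.comp_sub, h₁, h₂]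
  | of X =>
    rw [leftUnit_hom_eq_pull (S := S), ← push_id, push, prodMap_homOf, pull_comp_homOf]
    refine (homOf_comp_push _ _).trans (homOf_eq ?_)
    exact ⟨Equiv.punitProd _, fun _ _ => rfl, fun _ => rfl, fun _ => rfl⟩

lemma rightUnit_naturality (a : S ⟶ T) :
    prodMap a (𝟙 (point G)) ≫ (rightUnitIso T).hom = (rightUnitIso S).hom ≫ a := by
  induction a using hom_induction with
  | sub a₁ a₂ h₁ h₂ => simp only [prodMap_sub_left, Preadditive.sub_comp, Preadditive.comp_sub, h₁, h₂]
  | of X =>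
    rw [rightUnit_hom_eq_pull (S := S), ← push_id, push, prodMap_homOf, pull_comp_homOf]
    refine (homOf_comp_push _ _).trans (homOf_eq ?_)
    exact ⟨Equiv.prodPUnit _, fun _ _ => rfl, fun _ => rfl, fun _ => rfl⟩

lemma swap_naturality (a : S ⟶ S') (b : T ⟶ T') :
    prodMap a b ≫ (swapIso S' T').hom = (swapIso S T).hom ≫ prodMap b a := by
  induction a using hom_induction with
  | sub a₁ a₂ h₁ h₂ => simp only [prodMap_sub_left, prodMap_sub_right, Preadditive.sub_comp,
      Preadditive.comp_sub, h₁, h₂]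
  | of X =>
    induction b using hom_induction with
    | sub a₁ a₂ h₁ h₂ => simp only [prodMap_sub_left, prodMap_sub_right, Preadditive.sub_comp,
        Preadditive.comp_sub, h₁, h₂]
    | of Y =>
      rw [swap_hom_eq_pull (S := S), prodMap_homOf, prodMap_homOf, pull_comp_homOf]
      refine (homOf_comp_push _ _).trans (homOf_eq ?_)
      exact ⟨Equiv.prodComm _ _, fun _ _ => rfl, fun _ => rfl, fun _ => rfl⟩

/-- The Burnside category is monoidal under the cartesian product of finite `G`-sets. -/
instance : MonoidalCategory (Burnside G) :=
  MonoidalCategory.ofTensorHom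
    (id_tensorHom_id := fun S T => prodMap_push _ _)
    (id_tensorHom := fun _ _ _ _ => rfl)
    (tensorHom_id := fun _ _ => rfl)
    (tensorHom_comp_tensorHom := fun f₁ f₂ g₁ g₂ => prodMap_comp f₁ g₁ f₂ g₂)
    (associator_naturality := assoc_naturality)
    (leftUnitor_naturality := leftUnit_naturality)
    (rightUnitor_naturality := rightUnit_naturality)
    (pentagon := fun S T U V => by
      change prodMap (push _) (push _) ≫ push _ ≫ prodMap (push _) (push _) = push _ ≫ push _
      simp only [prodMap_push, push_comp]
      rfl)
    (triangle := fun S T => by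
      change push _ ≫ prodMap (push _) (push _) = prodMap (push _) (push _)
      simp only [prodMap_push, push_comp]
      rfl)

/-- The cartesian product of finite `G`-sets is symmetric on the Burnside category. -/
instance : SymmetricCategory (Burnside G) where
  braiding := swapIso
  braiding_naturality_right S _ _ f := swap_naturality (𝟙 S) f
  braiding_naturality_left f S := swap_naturality f (𝟙 S)
  hexagon_forward S T U := by
    change push _ ≫ push _ ≫ push _ = prodMap (push _) (push _) ≫ push _ ≫ prodMap (push _) (push _)
    simp only [prodMap_push, push_comp]
    rfl
  hexagon_reverse S T U := by
    change push _ ≫ push _ ≫ push _ = prodMap (push _) (push _) ≫ push _ ≫ prodMap (push _) (push _)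
    simp only [prodMap_push, push_comp]
    rfl
  symmetry S T := (swapIso S T).hom_inv_id

lemma add_tensorHom (a a' : S ⟶ T) (b : S' ⟶ T') : (a + a') ⊗ₘ b = a ⊗ₘ b + a' ⊗ₘ b :=
  prodMap_add_left a a' b

lemma tensorHom_add (a : S ⟶ T) (b b' : S' ⟶ T') : a ⊗ₘ (b + b') = a ⊗ₘ b + a ⊗ₘ b' :=
  prodMap_add_right a b b'

instance : MonoidalPreadditive (Burnside G) where
  whiskerLeft_zero {S T U} := map_zero (prodHom S S T U (𝟙 S))
  zero_whiskerRight {S T U} := by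
    change prodHom T U S S 0 (𝟙 S) = 0
    rw [map_zero, AddMonoidHom.zero_apply]
  whiskerLeft_add {S _ _} f g := prodMap_add_right (𝟙 S) f g
  add_whiskerRight {S _ _} f g := prodMap_add_left f g (𝟙 S)

/-! ### The Burnside category of a finite group is essentially small -/

/-- A diagram whose middle set has `n` elements, transported to `Fin n`. -/
def Span.code {n : ℕ} (X : Span S T) (h : Nat.card X.apex = n) :
    (G → Fin n → Fin n) × (Fin n → S) × (Fin n → T) :=
  let e := Finite.equivFinOfCardEq h
  (fun g i => e (g • e.symm i), fun i => X.l (e.symm i), fun i => X.r (e.symm i))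

lemma Span.iso_of_code_eq {n m : ℕ} (X Y : Span S T) (hX : Nat.card X.apex = n)
    (hY : Nat.card Y.apex = m)
    (h : (⟨n, X.code hX⟩ : Σ n, (G → Fin n → Fin n) × (Fin n → S) × (Fin n → T)) = ⟨m, Y.code hY⟩) :
    Iso X Y := by
  obtain ⟨rfl, h⟩ := Sigma.mk.inj_iff.1 h
  have h := eq_of_heq h
  refine ⟨(Finite.equivFinOfCardEq hX).trans (Finite.equivFinOfCardEq hY).symm,
    fun g x => ?_, fun x => ?_, fun x => ?_⟩
  · have := congrFun (congrFun (congrArg Prod.fst h) g) (Finite.equivFinOfCardEq hX x)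
    simp only [Span.code, Equiv.symm_apply_apply] at this
    simp [this]
  · have := congrFun (congrArg (fun p => p.2.1) h) (Finite.equivFinOfCardEq hX x)
    simp only [Span.code, Equiv.symm_apply_apply] at this
    simp [this]
  · have := congrFun (congrArg (fun p => p.2.2) h) (Finite.equivFinOfCardEq hX x)
    simp only [Span.code, Equiv.symm_apply_apply] at this
    simp [this]

/-- A finite `G`-set gives a diagram over the point. -/
def Span.ofObj (S : Burnside G) : Span (point G) (point G) :=
  ⟨S, ⟨fun _ => PUnit.unit, fun _ _ => rfl⟩, ⟨fun _ => PUnit.unit, fun _ _ => rfl⟩⟩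

instance [Finite G] (S T : Burnside G) : Countable (SpanClass S T) :=
  Function.Injective.countable
    (f := fun q : SpanClass S T =>
      (⟨_, Span.code q.out rfl⟩ : Σ n, (G → Fin n → Fin n) × (Fin n → S) × (Fin n → T)))
    fun q q' h => by
      rw [← q.out_eq, ← q'.out_eq]
      exact Quotient.sound (Span.iso_of_code_eq _ _ _ _ h)

instance [Finite G] (S T : Burnside G) : Countable (S ⟶ T) :=
  Function.Surjective.countable
    (f := fun p : SpanClass S T × SpanClass S T => (Mor.of S T p.1 - Mor.of S T p.2 : Mor S T))
    fun a => by
      obtain ⟨x, y, h⟩ := Mor.exists_sub a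
      exact ⟨(x, y), h.symm⟩

instance [Finite G] : LocallySmall.{w} (Burnside G) where

lemma nonempty_iso_of_span {S T : Burnside G} (h : Span.Iso (Span.ofObj S) (Span.ofObj T)) :
    Nonempty (S ≅ T) := by
  obtain ⟨e, he, -, -⟩ := h
  have he' : ∀ (g : G) x, e.symm (g • x) = g • e.symm x := fun g x => by
    rw [Equiv.symm_apply_eq, he, Equiv.apply_symm_apply]
  exact ⟨isoOf ⟨e, he⟩ ⟨e.symm, he'⟩ e.symm_apply_apply e.apply_symm_apply⟩

instance [Finite G] : Countable (Skeleton (Burnside G)) :=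
  Function.Injective.countable
    (f := fun q : Skeleton (Burnside G) =>
      (⟦Span.ofObj ((fromSkeleton _).obj q)⟧ : SpanClass (point G) (point G)))
    fun q q' h => by
      obtain ⟨e⟩ := nonempty_iso_of_span (Quotient.exact h)
      exact skeleton_skeletal _ ⟨(fromSkeleton _).preimageIso e⟩

instance [Finite G] : EssentiallySmall.{w} (Burnside G) :=
  (essentiallySmall_iff _).2 ⟨inferInstance, inferInstance⟩

instance [Finite G] : EssentiallySmall.{w} (Burnside G × Burnside G) :=
  EssentiallySmall.mk' ((equivSmallModel.{w} (Burnside G)).prod (equivSmallModel.{w} (Burnside G)))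

end Burnside

/-- Mackey functors for `G`: additive functors from the Burnside category to abelian groups. -/
abbrev Mackey (G : Type u) [Group G] := Burnside G ⥤+ AddCommGrpCat.{w}

namespace Mackey

open Burnside

variable {G : Type u} [Group G]

/-! ### The box product -/

section Box

variable (M N P Q : Burnside G ⥤ AddCommGrpCat.{w})

/-- The functor `(S, T) ↦ M(S) ⊗ N(T)`. -/
def extTensor : Burnside G × Burnside G ⥤ AddCommGrpCat.{w} where
  obj p := AddCommGrpCat.of (M.obj p.1 ⊗[ℤ] N.obj p.2)
  map f := AddCommGrpCat.ofHom (TensorProduct.map (M.map f.1).hom.toIntLinearMap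
    (N.map f.2).hom.toIntLinearMap).toAddMonoidHom
  map_id p := by
    ext x
    induction x using TensorProduct.induction_on with
    | zero => simp
    | add x y hx hy => rw [map_add, map_add, hx, hy]
    | tmul m n => simp
  map_comp f g := by
    ext x
    induction x using TensorProduct.induction_on with
    | zero => simp
    | add x y hx hy => rw [map_add, map_add, hx, hy]
    | tmul m n => simp

lemma tensor_addHom_ext {A B C : Type*} [AddCommGroup A] [AddCommGroup B] [AddCommGroup C]
    {φ ψ : A ⊗[ℤ] B →+ C} (h : ∀ a b, φ (a ⊗ₜ[ℤ] b) = ψ (a ⊗ₜ[ℤ] b)) : φ = ψ := by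
  ext x
  induction x using TensorProduct.induction_on with
  | zero => rw [map_zero, map_zero]
  | add x y hx hy => rw [map_add, map_add, hx, hy]
  | tmul m n => exact h m n

variable {M N P Q} in
lemma extTensor_hom_ext {p : Burnside G × Burnside G} {A : AddCommGrpCat.{w}}
    {φ ψ : (extTensor M N).obj p ⟶ A}
    (h : ∀ (m : M.obj p.1) (n : N.obj p.2), φ.hom (m ⊗ₜ[ℤ] n) = ψ.hom (m ⊗ₜ[ℤ] n)) : φ = ψ :=
  AddCommGrpCat.hom_ext (tensor_addHom_ext h)

variable [Finite G]

instance : (tensor (Burnside G)).HasPointwiseLeftKanExtension (extTensor M N) := fun U =>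
  haveI : Limits.HasColimitsOfShape (CostructuredArrow (tensor (Burnside G)) U)
      AddCommGrpCat.{w} :=
    Limits.hasColimitsOfShape_of_essentiallySmall.{w} _ _
  inferInstance

/-- The box product of two functors: the left Kan extension of `(S, T) ↦ M(S) ⊗ N(T)` along the
product functor on the Burnside category. -/
def boxFunctor : Burnside G ⥤ AddCommGrpCat.{w} :=
  (tensor (Burnside G)).leftKanExtension (extTensor M N)

/-- The universal natural transformation `M(S) ⊗ N(T) → (M □ N)(S × T)`. -/
def boxUnit : extTensor M N ⟶ tensor (Burnside G) ⋙ boxFunctor M N :=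
  (tensor (Burnside G)).leftKanExtensionUnit (extTensor M N)

instance : (boxFunctor M N).IsLeftKanExtension (boxUnit M N) :=
  inferInstanceAs (((tensor (Burnside G)).leftKanExtension (extTensor M N)).IsLeftKanExtension
    ((tensor (Burnside G)).leftKanExtensionUnit (extTensor M N)))

/-- The universal additive map `M(S) ⊗ N(T) → (M □ N)(S × T)`. -/
def boxUnitHom (S T : Burnside G) : M.obj S ⊗[ℤ] N.obj T →+ (boxFunctor M N).obj (S ⊗ T) :=
  ((boxUnit M N).app (S, T)).hom

/-- The universal biadditive map `M(S) × N(T) → (M □ N)(S × T)`. -/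
def boxMk (S T : Burnside G) : M.obj S →+ N.obj T →+ (boxFunctor M N).obj (S ⊗ T) :=
  AddMonoidHom.mk' (fun m => AddMonoidHom.mk' (fun n => boxUnitHom M N S T (m ⊗ₜ[ℤ] n))
      fun n n' => by rw [TensorProduct.tmul_add, map_add])
    fun m m' => by
      ext n
      change boxUnitHom M N S T ((m + m') ⊗ₜ[ℤ] n) = _
      rw [TensorProduct.add_tmul, map_add]
      rfl

variable {M N P Q}

lemma boxMk_natural {S S' T T' : Burnside G} (f : S ⟶ S') (g : T ⟶ T') (m : M.obj S) (n : N.obj T) :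
    (boxFunctor M N).map (f ⊗ₘ g) (boxMk M N S T m n) = boxMk M N S' T' (M.map f m) (N.map g n) :=
  (DFunLike.congr_fun (congrArg AddCommGrpCat.Hom.hom
    ((boxUnit M N).naturality (X := (S, T)) (Y := (S', T')) (Prod.mkHom f g)))
    (m ⊗ₜ[ℤ] n)).symm

variable (M N P) in
/-- A pairing of `M` and `N` with values in `P`: biadditive maps `M(S) × N(T) → P(S × T)` natural
with respect to the morphisms of the Burnside category. -/
structure Pairing where
  /-- the biadditive maps -/
  app (S T : Burnside G) : M.obj S →+ N.obj T →+ P.obj (S ⊗ T)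
  natural {S S' T T' : Burnside G} (f : S ⟶ S') (g : T ⟶ T') (m : M.obj S) (n : N.obj T) :
    P.map (f ⊗ₘ g) (app S T m n) = app S' T' (M.map f m) (N.map g n)

/-- The natural transformation out of the box product given by a pairing. -/
def boxDesc (φ : Pairing M N P) : boxFunctor M N ⟶ P :=
  (boxFunctor M N).descOfIsLeftKanExtension (boxUnit M N) P
    { app := fun p => AddCommGrpCat.ofHom (TensorProduct.liftAddHom (φ.app p.1 p.2)
        (fun r m n => by simp))
      naturality := by
        rintro ⟨S, T⟩ ⟨S', T'⟩ ⟨f, g⟩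
        exact extTensor_hom_ext fun m n => (φ.natural f g m n).symm }

lemma boxDesc_boxMk (φ : Pairing M N P) {S T : Burnside G} (m : M.obj S) (n : N.obj T) :
    (boxDesc φ).app (S ⊗ T) (boxMk M N S T m n) = φ.app S T m n :=
  DFunLike.congr_fun (congrArg AddCommGrpCat.Hom.hom
    ((boxFunctor M N).descOfIsLeftKanExtension_fac_app (boxUnit M N) P _ (S, T)))
    (m ⊗ₜ[ℤ] n)

lemma box_hom_ext {φ ψ : boxFunctor M N ⟶ P}
    (h : ∀ (S T : Burnside G) (m : M.obj S) (n : N.obj T),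
      φ.app (S ⊗ T) (boxMk M N S T m n) = ψ.app (S ⊗ T) (boxMk M N S T m n)) : φ = ψ := by
  refine (boxFunctor M N).hom_ext_of_isLeftKanExtension (boxUnit M N) _ _ ?_
  ext1
  funext p
  exact extTensor_hom_ext fun m n => h p.1 p.2 m n

lemma box_hom_ext_at {U : Burnside G} {A : AddCommGrpCat.{w}} {φ ψ : (boxFunctor M N).obj U ⟶ A}
    (h : ∀ (S T : Burnside G) (f : S ⊗ T ⟶ U) (m : M.obj S) (n : N.obj T),
      φ ((boxFunctor M N).map f (boxMk M N S T m n)) =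
        ψ ((boxFunctor M N).map f (boxMk M N S T m n))) : φ = ψ := by
  refine Limits.IsColimit.hom_ext (Functor.isPointwiseLeftKanExtensionOfIsLeftKanExtension
    (boxFunctor M N) (boxUnit M N) U) fun j => ?_
  refine extTensor_hom_ext fun m n => h _ _ j.hom m n

lemma box_induction {U : Burnside G} {p : (boxFunctor M N).obj U → Prop}
    (mk : ∀ (S T : Burnside G) (f : S ⊗ T ⟶ U) (m : M.obj S) (n : N.obj T),
      p ((boxFunctor M N).map f (boxMk M N S T m n)))
    (zero : p 0) (add : ∀ x y, p x → p y → p (x + y)) (neg : ∀ x, p x → p (-x))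
    (x : (boxFunctor M N).obj U) : p x := by
  let K : AddSubgroup ((boxFunctor M N).obj U) :=
    { carrier := p, zero_mem' := zero, add_mem' := fun {x y} => add x y, neg_mem' := fun {x} => neg x }
  have : AddCommGrpCat.ofHom (QuotientAddGroup.mk' K) = 0 :=
    box_hom_ext_at fun S T f m n => (QuotientAddGroup.eq_zero_iff _).2 (mk S T f m n)
  exact (QuotientAddGroup.eq_zero_iff x).1
    (DFunLike.congr_fun (congrArg AddCommGrpCat.Hom.hom this) x)

end Box

section Monoidal

variable {M N P Q R M' N' P' : Burnside G ⥤ AddCommGrpCat.{w}}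

lemma map_comp_elem (M : Burnside G ⥤ AddCommGrpCat.{w}) {S T U : Burnside G} (f : S ⟶ T)
    (g : T ⟶ U) (m : M.obj S) : M.map g (M.map f m) = M.map (f ≫ g) m := by
  rw [M.map_comp]; rfl

lemma map_id_elem (M : Burnside G ⥤ AddCommGrpCat.{w}) {S : Burnside G} (m : M.obj S) :
    M.map (𝟙 S) m = m := by
  rw [M.map_id]; rfl

lemma app_map_elem (φ : M ⟶ N) {S T : Burnside G} (f : S ⟶ T) (m : M.obj S) :
    φ.app T (M.map f m) = N.map f (φ.app S m) :=
  DFunLike.congr_fun (congrArg AddCommGrpCat.Hom.hom (φ.naturality f)) m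

lemma app_comp_elem (φ : M ⟶ N) (ψ : N ⟶ P) {S : Burnside G} (m : M.obj S) :
    (φ ≫ ψ).app S m = ψ.app S (φ.app S m) := rfl

lemma app_id_elem {S : Burnside G} (m : M.obj S) : (𝟙 M : M ⟶ M).app S m = m := rfl

variable [Finite G]

lemma boxMk_map_left {S S' T : Burnside G} (f : S ⟶ S') (m : M.obj S) (n : N.obj T) :
    boxMk M N S' T (M.map f m) n = (boxFunctor M N).map (f ▷ T) (boxMk M N S T m n) := by
  rw [← tensorHom_id, boxMk_natural, map_id_elem]

lemma boxMk_map_right {S T T' : Burnside G} (g : T ⟶ T') (m : M.obj S) (n : N.obj T) :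
    boxMk M N S T' m (N.map g n) = (boxFunctor M N).map (S ◁ g) (boxMk M N S T m n) := by
  rw [← id_tensorHom, boxMk_natural, map_id_elem]

/-- Functoriality of the box product. -/
def boxMap (φ : M ⟶ M') (ψ : N ⟶ N') : boxFunctor M N ⟶ boxFunctor M' N' :=
  boxDesc
    { app := fun S T => ((boxMk M' N' S T).comp (φ.app S).hom).compl₂ (ψ.app T).hom
      natural := fun f g m n => by
        change (boxFunctor M' N').map (f ⊗ₘ g) (boxMk M' N' _ _ (φ.app _ m) (ψ.app _ n)) =
          boxMk M' N' _ _ (φ.app _ (M.map f m)) (ψ.app _ (N.map g n))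
        rw [boxMk_natural, app_map_elem, app_map_elem] }

lemma boxMap_boxMk (φ : M ⟶ M') (ψ : N ⟶ N') {S T : Burnside G} (m : M.obj S) (n : N.obj T) :
    (boxMap φ ψ).app (S ⊗ T) (boxMk M N S T m n) = boxMk M' N' S T (φ.app S m) (ψ.app T n) :=
  boxDesc_boxMk _ m n

/-- Pairings out of `M □ N`, for a fixed second variable. -/
def assocAux (M N P : Burnside G ⥤ AddCommGrpCat.{w}) {U : Burnside G} (p : P.obj U) :
    boxFunctor M N ⟶ tensorRight U ⋙ boxFunctor M (boxFunctor N P) :=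
  boxDesc
    { app := fun S T => AddMonoidHom.mk' (fun m => AddMonoidHom.mk' (fun n =>
          (boxFunctor M (boxFunctor N P)).map (α_ S T U).inv
            (boxMk M (boxFunctor N P) S (T ⊗ U) m (boxMk N P T U n p)))
          (fun n n' => by simp only [map_add, AddMonoidHom.add_apply]))
          (fun m m' => by ext n; simp)
      natural := fun {S S' T T'} f g m n => by
        change (boxFunctor M (boxFunctor N P)).map ((f ⊗ₘ g) ▷ U)
          ((boxFunctor M (boxFunctor N P)).map (α_ S T U).inv
            (boxMk M (boxFunctor N P) S (T ⊗ U) m (boxMk N P T U n p))) =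
          (boxFunctor M (boxFunctor N P)).map (α_ S' T' U).inv
            (boxMk M (boxFunctor N P) S' (T' ⊗ U) (M.map f m) (boxMk N P T' U (N.map g n) p))
        rw [boxMk_map_left, boxMk_map_left, boxMk_map_right, map_comp_elem, map_comp_elem,
          map_comp_elem]
        congr 3
        simp [tensorHom_def'] }

lemma assocAux_boxMk {S T U : Burnside G} (m : M.obj S) (n : N.obj T) (p : P.obj U) :
    (assocAux M N P p).app (S ⊗ T) (boxMk M N S T m n) =
      (boxFunctor M (boxFunctor N P)).map (α_ S T U).inv
            (boxMk M (boxFunctor N P) S (T ⊗ U) m (boxMk N P T U n p)) :=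
  boxDesc_boxMk _ m n

/-- Pairings out of `N □ P`, for a fixed first variable. -/
def assocInvAux (M N P : Burnside G ⥤ AddCommGrpCat.{w}) {S : Burnside G} (m : M.obj S) :
    boxFunctor N P ⟶ tensorLeft S ⋙ boxFunctor (boxFunctor M N) P :=
  boxDesc
    { app := fun T U => AddMonoidHom.mk' (fun n => AddMonoidHom.mk' (fun p =>
          (boxFunctor (boxFunctor M N) P).map (α_ S T U).hom
            (boxMk (boxFunctor M N) P (S ⊗ T) U (boxMk M N S T m n) p))
          (fun n n' => by simp only [map_add]))
          (fun m m' => by ext n; simp)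
      natural := fun {T T' U U'} f g n p => by
        change (boxFunctor (boxFunctor M N) P).map (S ◁ (f ⊗ₘ g))
          ((boxFunctor (boxFunctor M N) P).map (α_ S T U).hom
            (boxMk (boxFunctor M N) P (S ⊗ T) U (boxMk M N S T m n) p)) =
          (boxFunctor (boxFunctor M N) P).map (α_ S T' U').hom
            (boxMk (boxFunctor M N) P (S ⊗ T') U' (boxMk M N S T' m (N.map f n)) (P.map g p))
        rw [boxMk_map_right, boxMk_map_right, boxMk_map_left, map_comp_elem, map_comp_elem,
          map_comp_elem]
        congr 3
        simp [MonoidalCategory.tensorHom_def] }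

lemma assocInvAux_boxMk {S T U : Burnside G} (m : M.obj S) (n : N.obj T) (p : P.obj U) :
    (assocInvAux M N P m).app (T ⊗ U) (boxMk N P T U n p) =
      (boxFunctor (boxFunctor M N) P).map (α_ S T U).hom
            (boxMk (boxFunctor M N) P (S ⊗ T) U (boxMk M N S T m n) p) :=
  boxDesc_boxMk _ n p

lemma box_addHom_ext {U : Burnside G} {A : Type*} [AddCommGroup A]
    {φ ψ : (boxFunctor M N).obj U →+ A}
    (h : ∀ (S T : Burnside G) (f : S ⊗ T ⟶ U) (m : M.obj S) (n : N.obj T),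
      φ ((boxFunctor M N).map f (boxMk M N S T m n)) =
        ψ ((boxFunctor M N).map f (boxMk M N S T m n))) : φ = ψ := by
  ext x
  induction x using box_induction with
  | mk S T f m n => exact h S T f m n
  | zero => rw [map_zero, map_zero]
  | add x y hx hy => rw [map_add, map_add, hx, hy]
  | neg x hx => rw [map_neg, map_neg, hx]

/-- The associativity morphism of the box product. -/
def boxAssocHom (M N P : Burnside G ⥤ AddCommGrpCat.{w}) :
    boxFunctor (boxFunctor M N) P ⟶ boxFunctor M (boxFunctor N P) :=
  boxDesc
    { app := fun U V => AddMonoidHom.flip (AddMonoidHom.mk' (fun p => ((assocAux M N P p).app U).hom)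
        fun p p' => box_addHom_ext fun S T f m n => by
          change (assocAux M N P (p + p')).app U _ =
            (assocAux M N P p).app U _ + (assocAux M N P p').app U _
          simp only [app_map_elem, assocAux_boxMk, map_add])
      natural := fun {U U' V V'} f g x p => by
        change (boxFunctor M (boxFunctor N P)).map (f ⊗ₘ g) ((assocAux M N P p).app U x) =
          (assocAux M N P (P.map g p)).app U' ((boxFunctor M N).map f x)
        induction x using box_induction with
        | zero => simp only [map_zero]
        | add x y hx hy => simp only [map_add, hx, hy]
        | neg x hx => simp only [map_neg, hx]
        | mk S T h m n =>
          rw [map_comp_elem, app_map_elem, app_map_elem, assocAux_boxMk, assocAux_boxMk,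
            boxMk_map_right, boxMk_map_right]
          dsimp only [Functor.comp_map, tensorRight, Functor.flip_obj_map, curriedTensor_map_app]
          simp only [map_comp_elem]
          congr 3
          simp [tensorHom_def', ← whisker_exchange_assoc] }

lemma boxAssocHom_boxMk {S T U : Burnside G} (m : M.obj S) (n : N.obj T) (p : P.obj U) :
    (boxAssocHom M N P).app _ (boxMk (boxFunctor M N) P (S ⊗ T) U (boxMk M N S T m n) p) =
      (boxFunctor M (boxFunctor N P)).map (α_ S T U).inv
            (boxMk M (boxFunctor N P) S (T ⊗ U) m (boxMk N P T U n p)) :=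
  (boxDesc_boxMk _ _ _).trans (assocAux_boxMk m n p)

/-- The inverse of the associativity morphism of the box product. -/
def boxAssocInv (M N P : Burnside G ⥤ AddCommGrpCat.{w}) :
    boxFunctor M (boxFunctor N P) ⟶ boxFunctor (boxFunctor M N) P :=
  boxDesc
    { app := fun U V => AddMonoidHom.mk' (fun m => ((assocInvAux M N P m).app V).hom)
        fun m m' => box_addHom_ext fun S T f n p => by
          change (assocInvAux M N P (m + m')).app V _ =
            (assocInvAux M N P m).app V _ + (assocInvAux M N P m').app V _
          simp only [app_map_elem, assocInvAux_boxMk, map_add, AddMonoidHom.add_apply]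
      natural := fun {U U' V V'} f g m x => by
        change (boxFunctor (boxFunctor M N) P).map (f ⊗ₘ g) ((assocInvAux M N P m).app V x) =
          (assocInvAux M N P (M.map f m)).app V' ((boxFunctor N P).map g x)
        induction x using box_induction with
        | zero => simp only [map_zero]
        | add x y hx hy => simp only [map_add, hx, hy]
        | neg x hx => simp only [map_neg, hx]
        | mk S T h n p =>
          rw [map_comp_elem, app_map_elem, app_map_elem, assocInvAux_boxMk, assocInvAux_boxMk,
            boxMk_map_left, boxMk_map_left]
          dsimp only [Functor.comp_map, tensorLeft, curriedTensor_obj_map]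
          simp only [map_comp_elem]
          congr 3
          simp [MonoidalCategory.tensorHom_def, whisker_exchange_assoc] }

lemma boxAssocInv_boxMk {S T U : Burnside G} (m : M.obj S) (n : N.obj T) (p : P.obj U) :
    (boxAssocInv M N P).app _ (boxMk M (boxFunctor N P) S (T ⊗ U) m (boxMk N P T U n p)) =
      (boxFunctor (boxFunctor M N) P).map (α_ S T U).hom
            (boxMk (boxFunctor M N) P (S ⊗ T) U (boxMk M N S T m n) p) :=
  (boxDesc_boxMk _ _ _).trans (assocInvAux_boxMk m n p)

lemma box_hom_ext₃ {φ ψ : boxFunctor (boxFunctor M N) P ⟶ Q}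
    (h : ∀ (S T U : Burnside G) (m : M.obj S) (n : N.obj T) (p : P.obj U),
      φ.app _ (boxMk (boxFunctor M N) P (S ⊗ T) U (boxMk M N S T m n) p) =
        ψ.app _ (boxMk (boxFunctor M N) P (S ⊗ T) U (boxMk M N S T m n) p)) : φ = ψ := by
  refine box_hom_ext fun U V x p => ?_
  induction x using box_induction with
  | zero => simp only [map_zero, AddMonoidHom.zero_apply]
  | add x y hx hy => simp only [map_add, AddMonoidHom.add_apply, hx, hy]
  | neg x hx => simp only [map_neg, AddMonoidHom.neg_apply, hx]
  | mk S T f m n => rw [boxMk_map_left, app_map_elem, app_map_elem, h]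

lemma box_hom_ext₃' {φ ψ : boxFunctor M (boxFunctor N P) ⟶ Q}
    (h : ∀ (S T U : Burnside G) (m : M.obj S) (n : N.obj T) (p : P.obj U),
      φ.app _ (boxMk M (boxFunctor N P) S (T ⊗ U) m (boxMk N P T U n p)) =
        ψ.app _ (boxMk M (boxFunctor N P) S (T ⊗ U) m (boxMk N P T U n p))) : φ = ψ := by
  refine box_hom_ext fun U V m x => ?_
  induction x using box_induction with
  | zero => simp only [map_zero]
  | add x y hx hy => simp only [map_add, hx, hy]
  | neg x hx => simp only [map_neg, hx]
  | mk S T f n p => rw [boxMk_map_right, app_map_elem, app_map_elem, h]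

lemma box_hom_ext₄ {φ ψ : boxFunctor (boxFunctor (boxFunctor M N) P) Q ⟶ R}
    (h : ∀ (S T U V : Burnside G) (m : M.obj S) (n : N.obj T) (p : P.obj U) (q : Q.obj V),
      φ.app _ (boxMk _ _ _ _ (boxMk _ _ _ _ (boxMk M N S T m n) p) q) =
        ψ.app _ (boxMk _ _ _ _ (boxMk _ _ _ _ (boxMk M N S T m n) p) q)) : φ = ψ := by
  refine box_hom_ext₃ fun W U V x p q => ?_
  induction x using box_induction with
  | zero => simp only [map_zero, AddMonoidHom.zero_apply]
  | add x y hx hy => simp only [map_add, AddMonoidHom.add_apply, hx, hy]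
  | neg x hx => simp only [map_neg, AddMonoidHom.neg_apply, hx]
  | mk S T f m n => rw [boxMk_map_left, boxMk_map_left, app_map_elem, app_map_elem, h]

/-- The associativity isomorphism of the box product. -/
def boxAssoc (M N P : Burnside G ⥤ AddCommGrpCat.{w}) :
    boxFunctor (boxFunctor M N) P ≅ boxFunctor M (boxFunctor N P) where
  hom := boxAssocHom M N P
  inv := boxAssocInv M N P
  hom_inv_id := box_hom_ext₃ fun S T U m n p => by
    rw [app_comp_elem, boxAssocHom_boxMk, app_map_elem, boxAssocInv_boxMk, map_comp_elem,
      Iso.hom_inv_id, map_id_elem, app_id_elem]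
  inv_hom_id := box_hom_ext₃' fun S T U m n p => by
    rw [app_comp_elem, boxAssocInv_boxMk, app_map_elem, boxAssocHom_boxMk, map_comp_elem,
      Iso.inv_hom_id, map_id_elem, app_id_elem]

/-- The symmetry morphism of the box product. -/
def boxSwapHom (M N : Burnside G ⥤ AddCommGrpCat.{w}) : boxFunctor M N ⟶ boxFunctor N M :=
  boxDesc
    { app := fun S T => AddMonoidHom.mk' (fun m => AddMonoidHom.mk' (fun n =>
          (boxFunctor N M).map (β_ T S).hom (boxMk N M T S n m))
          (fun n n' => by simp only [map_add, AddMonoidHom.add_apply]))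
          (fun m m' => by ext n; simp)
      natural := fun {S S' T T'} f g m n => by
        change (boxFunctor N M).map (f ⊗ₘ g) ((boxFunctor N M).map (β_ T S).hom (boxMk N M T S n m)) =
          (boxFunctor N M).map (β_ T' S').hom (boxMk N M T' S' (N.map g n) (M.map f m))
        rw [← boxMk_natural, map_comp_elem, map_comp_elem]
        congr 3
        simp }

lemma boxSwapHom_boxMk {S T : Burnside G} (m : M.obj S) (n : N.obj T) :
    (boxSwapHom M N).app _ (boxMk M N S T m n) =
      (boxFunctor N M).map (β_ T S).hom (boxMk N M T S n m) :=
  boxDesc_boxMk _ m n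

/-- The symmetry isomorphism of the box product. -/
def boxSwap (M N : Burnside G ⥤ AddCommGrpCat.{w}) : boxFunctor M N ≅ boxFunctor N M where
  hom := boxSwapHom M N
  inv := boxSwapHom N M
  hom_inv_id := box_hom_ext fun S T m n => by
    rw [app_comp_elem, boxSwapHom_boxMk, app_map_elem, boxSwapHom_boxMk, map_comp_elem,
      SymmetricCategory.symmetry, map_id_elem, app_id_elem]
  inv_hom_id := box_hom_ext fun S T m n => by
    rw [app_comp_elem, boxSwapHom_boxMk, app_map_elem, boxSwapHom_boxMk, map_comp_elem,
      SymmetricCategory.symmetry, map_id_elem, app_id_elem]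

end Monoidal

section Additive

variable (S T U : Burnside G)

/-- The inclusion of the first summand of `S ⨿ S`. -/
def inlMap (S : Burnside G) : S →[G] S.sum S := ⟨Sum.inl, fun _ _ => rfl⟩

/-- The inclusion of the second summand of `S ⨿ S`. -/
def inrMap (S : Burnside G) : S →[G] S.sum S := ⟨Sum.inr, fun _ _ => rfl⟩

lemma push_inl_pull_inl : push (inlMap S) ≫ pull (inlMap S) = 𝟙 S :=
  (homOf_comp _ _).trans (homOf_eq
    ⟨⟨fun p => p.1.1, fun s => ⟨(s, s), rfl⟩, fun p => Subtype.ext (Prod.ext rfl (Sum.inl_injective p.2)),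
      fun _ => rfl⟩, fun _ _ => rfl, fun _ => rfl, fun p => Sum.inl_injective p.2⟩)

lemma push_inr_pull_inr : push (inrMap S) ≫ pull (inrMap S) = 𝟙 S :=
  (homOf_comp _ _).trans (homOf_eq
    ⟨⟨fun p => p.1.1, fun s => ⟨(s, s), rfl⟩, fun p => Subtype.ext (Prod.ext rfl (Sum.inr_injective p.2)),
      fun _ => rfl⟩, fun _ _ => rfl, fun _ => rfl, fun p => Sum.inr_injective p.2⟩)

lemma push_inl_pull_inr : push (inlMap S) ≫ pull (inrMap S) = 0 := by
  have key : ∀ p : Span.PullbackType (Span.push (inlMap S)) (Span.pull (inrMap S)), False :=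
    fun p => Sum.inl_ne_inr p.2
  exact (homOf_comp _ _).trans ((homOf_eq (Y := Span.empty S S)
    ⟨⟨fun p => (key p).elim, fun x => PEmpty.elim x, fun p => (key p).elim, fun x => PEmpty.elim x⟩,
      fun _ p => (key p).elim, fun p => (key p).elim, fun p => (key p).elim⟩).trans ofSpan_empty)

lemma push_inr_pull_inl : push (inrMap S) ≫ pull (inlMap S) = 0 := by
  have key : ∀ p : Span.PullbackType (Span.push (inrMap S)) (Span.pull (inlMap S)), False :=
    fun p => Sum.inr_ne_inl p.2
  exact (homOf_comp _ _).trans ((homOf_eq (Y := Span.empty S S)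
    ⟨⟨fun p => (key p).elim, fun x => PEmpty.elim x, fun p => (key p).elim, fun x => PEmpty.elim x⟩,
      fun _ p => (key p).elim, fun p => (key p).elim, fun p => (key p).elim⟩).trans ofSpan_empty)

variable {S T U} in
lemma exists_copair (a b : S ⊗ T ⟶ U) : ∃ c : S.sum S ⊗ T ⟶ U,
    push (inlMap S) ▷ T ≫ c = a ∧ push (inrMap S) ▷ T ≫ c = b := by
  refine ⟨pull (inlMap S) ▷ T ≫ a + pull (inrMap S) ▷ T ≫ b, ?_, ?_⟩
  · rw [Preadditive.comp_add, ← comp_whiskerRight_assoc, ← comp_whiskerRight_assoc,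
      push_inl_pull_inl, push_inl_pull_inr]
    simp
  · rw [Preadditive.comp_add, ← comp_whiskerRight_assoc, ← comp_whiskerRight_assoc,
      push_inr_pull_inr, push_inr_pull_inl]
    simp

variable {M N P : Burnside G ⥤ AddCommGrpCat.{w}}

lemma map_add_elem (M : Burnside G ⥤ AddCommGrpCat.{w}) [M.Additive] {S T : Burnside G}
    (f g : S ⟶ T) (m : M.obj S) : M.map (f + g) m = M.map f m + M.map g m := by
  rw [M.map_add]; rfl

instance [Finite G] [M.Additive] : (boxFunctor M N).Additive where
  map_add {U V a b} := box_hom_ext_at fun S T f m n => by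
    change (boxFunctor M N).map (a + b) _ = (boxFunctor M N).map a _ + (boxFunctor M N).map b _
    simp only [map_comp_elem, Preadditive.comp_add]
    obtain ⟨c, hc, hc'⟩ := exists_copair (f ≫ a) (f ≫ b)
    rw [← hc, ← hc', ← Preadditive.add_comp, ← MonoidalPreadditive.add_whiskerRight]
    simp only [← map_comp_elem (boxFunctor M N), ← boxMk_map_left]
    rw [map_add_elem]
    simp only [map_add, AddMonoidHom.add_apply]

end Additive

section Unit

variable [Finite G]

/-- The functor underlying the Burnside Green functor, `S ↦ Hom(pt, S)`. -/
def unitFunctor (G : Type u) [Group G] [Finite G] : Burnside G ⥤ AddCommGrpCat.{w} where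
  obj S := AddCommGrpCat.of (Shrink.{w} (𝟙_ (Burnside G) ⟶ S))
  map {S T} f := AddCommGrpCat.ofHom (AddMonoidHom.mk' (fun a => equivShrink _
    ((equivShrink _).symm a ≫ f)) fun a b => by simp [Preadditive.add_comp])
  map_id S := by ext a; simp
  map_comp f g := by ext a; simp

/-- The elements of the Burnside Green functor at `S` are the morphisms `pt ⟶ S`. -/
def unitEquiv (S : Burnside G) : (𝟙_ (Burnside G) ⟶ S) ≃+ (unitFunctor.{w} G).obj S :=
  Shrink.addEquiv.symm

lemma unitFunctor_map {S T : Burnside G} (f : S ⟶ T) (a : 𝟙_ (Burnside G) ⟶ S) :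
    (unitFunctor.{w} G).map f (unitEquiv S a) = unitEquiv T (a ≫ f) :=
  congrArg (fun x => equivShrink _ (x ≫ f)) ((equivShrink _).symm_apply_apply a)

instance : (unitFunctor.{w} G).Additive where
  map_add {S T f g} := by
    ext a
    obtain ⟨a, rfl⟩ := (unitEquiv S).surjective a
    change (unitFunctor.{w} G).map (f + g) _ = (unitFunctor.{w} G).map f _ + (unitFunctor.{w} G).map g _
    rw [unitFunctor_map, unitFunctor_map, unitFunctor_map, Preadditive.comp_add, map_add]

variable (M : Burnside G ⥤ AddCommGrpCat.{w}) [M.Additive]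

/-- The left unit morphism of the box product. -/
def boxLeftUnitHom : boxFunctor (unitFunctor.{w} G) M ⟶ M :=
  boxDesc
    { app := fun S T => AddMonoidHom.mk' (fun a =>
          (M.map ((λ_ T).inv ≫ (unitEquiv S).symm a ▷ T)).hom)
          (fun a b => by rw [map_add, MonoidalPreadditive.add_whiskerRight, Preadditive.comp_add, M.map_add]; rfl)
      natural := fun {S S' T T'} f g a m => by
        obtain ⟨a, rfl⟩ := (unitEquiv S).surjective a
        change M.map (f ⊗ₘ g) (M.map ((λ_ T).inv ≫ (unitEquiv S).symm _ ▷ T) m) =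
          M.map ((λ_ T').inv ≫ (unitEquiv S').symm _ ▷ T') (M.map g m)
        rw [unitFunctor_map, AddEquiv.symm_apply_apply, AddEquiv.symm_apply_apply, map_comp_elem,
          map_comp_elem]
        congr 3
        simp only [MonoidalCategory.tensorHom_def, comp_whiskerRight, Category.assoc]
        rw [leftUnitor_inv_naturality_assoc, whisker_exchange_assoc, whisker_exchange] }

lemma boxLeftUnitHom_boxMk {S T : Burnside G} (a : 𝟙_ _ ⟶ S) (m : M.obj T) :
    (boxLeftUnitHom M).app _ (boxMk (unitFunctor.{w} G) M S T (unitEquiv S a) m) =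
      M.map ((λ_ T).inv ≫ a ▷ T) m := by
  refine (boxDesc_boxMk _ _ m).trans ?_
  change M.map ((λ_ T).inv ≫ (unitEquiv S).symm _ ▷ T) m = _
  rw [AddEquiv.symm_apply_apply]

/-- The right unit morphism of the box product. -/
def boxRightUnitHom : boxFunctor M (unitFunctor.{w} G) ⟶ M :=
  boxDesc
    { app := fun S T => AddMonoidHom.flip (AddMonoidHom.mk' (fun a =>
          (M.map ((ρ_ S).inv ≫ S ◁ (unitEquiv T).symm a)).hom)
          (fun a b => by rw [map_add, MonoidalPreadditive.whiskerLeft_add, Preadditive.comp_add, M.map_add]; rfl))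
      natural := fun {S S' T T'} f g m a => by
        obtain ⟨a, rfl⟩ := (unitEquiv T).surjective a
        change M.map (f ⊗ₘ g) (M.map ((ρ_ S).inv ≫ S ◁ (unitEquiv T).symm _) m) =
          M.map ((ρ_ S').inv ≫ S' ◁ (unitEquiv T').symm _) (M.map f m)
        rw [unitFunctor_map, AddEquiv.symm_apply_apply, AddEquiv.symm_apply_apply, map_comp_elem,
          map_comp_elem]
        congr 3
        simp only [tensorHom_def', MonoidalCategory.whiskerLeft_comp, Category.assoc]
        rw [rightUnitor_inv_naturality_assoc, ← whisker_exchange_assoc, ← whisker_exchange] }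

lemma boxRightUnitHom_boxMk {S T : Burnside G} (m : M.obj S) (a : 𝟙_ _ ⟶ T) :
    (boxRightUnitHom M).app _ (boxMk M (unitFunctor.{w} G) S T m (unitEquiv T a)) =
      M.map ((ρ_ S).inv ≫ S ◁ a) m := by
  refine (boxDesc_boxMk _ m _).trans ?_
  change M.map ((ρ_ S).inv ≫ S ◁ (unitEquiv T).symm _) m = _
  rw [AddEquiv.symm_apply_apply]

/-- The left unit isomorphism of the box product. -/
def boxLeftUnit : boxFunctor (unitFunctor.{w} G) M ≅ M where
  hom := boxLeftUnitHom M
  inv :=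
    { app := fun T => AddCommGrpCat.ofHom (((boxFunctor (unitFunctor.{w} G) M).map (λ_ T).hom).hom.comp
        (boxMk (unitFunctor.{w} G) M (𝟙_ _) T (unitEquiv _ (𝟙 _))))
      naturality := fun S T f => by
        ext m
        change (boxFunctor (unitFunctor.{w} G) M).map (λ_ T).hom (boxMk _ M _ _ _ (M.map f m)) =
          (boxFunctor (unitFunctor.{w} G) M).map f
            ((boxFunctor (unitFunctor.{w} G) M).map (λ_ S).hom (boxMk _ M _ _ _ m))
        rw [boxMk_map_right, map_comp_elem, map_comp_elem, leftUnitor_naturality] }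
  hom_inv_id := box_hom_ext fun S T a m => by
    obtain ⟨a, rfl⟩ := (unitEquiv S).surjective a
    rw [app_comp_elem, boxLeftUnitHom_boxMk]
    change (boxFunctor (unitFunctor.{w} G) M).map (λ_ (S ⊗ T)).hom
      (boxMk _ M _ _ (unitEquiv _ (𝟙 _)) (M.map _ m)) = _
    rw [boxMk_map_right, map_comp_elem, leftUnitor_naturality, Iso.hom_inv_id_assoc,
      ← boxMk_map_left, unitFunctor_map, Category.id_comp, app_id_elem]
  inv_hom_id := by
    ext T m
    change (boxLeftUnitHom M).app T ((boxFunctor (unitFunctor.{w} G) M).map (λ_ T).hom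
      (boxMk _ M _ _ (unitEquiv _ (𝟙 _)) m)) = m
    rw [app_map_elem, boxLeftUnitHom_boxMk, map_comp_elem]
    simp

/-- The right unit isomorphism of the box product. -/
def boxRightUnit : boxFunctor M (unitFunctor.{w} G) ≅ M where
  hom := boxRightUnitHom M
  inv :=
    { app := fun T => AddCommGrpCat.ofHom (((boxFunctor M (unitFunctor.{w} G)).map (ρ_ T).hom).hom.comp
        ((boxMk M (unitFunctor.{w} G) T (𝟙_ _)).flip (unitEquiv _ (𝟙 _))))
      naturality := fun S T f => by
        ext m
        change (boxFunctor M (unitFunctor.{w} G)).map (ρ_ T).hom (boxMk M _ _ _ (M.map f m) _) =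
          (boxFunctor M (unitFunctor.{w} G)).map f
            ((boxFunctor M (unitFunctor.{w} G)).map (ρ_ S).hom (boxMk M _ _ _ m _))
        rw [boxMk_map_left, map_comp_elem, map_comp_elem, rightUnitor_naturality] }
  hom_inv_id := box_hom_ext fun S T m a => by
    obtain ⟨a, rfl⟩ := (unitEquiv T).surjective a
    rw [app_comp_elem, boxRightUnitHom_boxMk]
    change (boxFunctor M (unitFunctor.{w} G)).map (ρ_ (S ⊗ T)).hom
      (boxMk M _ _ _ (M.map _ m) (unitEquiv _ (𝟙 _))) = _
    rw [boxMk_map_left, map_comp_elem, rightUnitor_naturality, Iso.hom_inv_id_assoc,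
      ← boxMk_map_right, unitFunctor_map, Category.id_comp, app_id_elem]
  inv_hom_id := by
    ext T m
    change (boxRightUnitHom M).app T ((boxFunctor M (unitFunctor.{w} G)).map (ρ_ T).hom
      (boxMk M _ _ _ m (unitEquiv _ (𝟙 _)))) = m
    rw [app_map_elem, boxRightUnitHom_boxMk, map_comp_elem]
    simp

lemma boxLeftUnit_naturality {M N : Burnside G ⥤ AddCommGrpCat.{w}} [M.Additive] [N.Additive]
    (f : M ⟶ N) :
    boxMap (𝟙 (unitFunctor.{w} G)) f ≫ boxLeftUnitHom N = boxLeftUnitHom M ≫ f :=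
  box_hom_ext fun S T a m => by
    obtain ⟨a, rfl⟩ := (unitEquiv S).surjective a
    rw [app_comp_elem, app_comp_elem, boxMap_boxMk, app_id_elem, boxLeftUnitHom_boxMk,
      boxLeftUnitHom_boxMk, app_map_elem]

lemma boxRightUnit_naturality {M N : Burnside G ⥤ AddCommGrpCat.{w}} [M.Additive] [N.Additive]
    (f : M ⟶ N) :
    boxMap f (𝟙 (unitFunctor.{w} G)) ≫ boxRightUnitHom N = boxRightUnitHom M ≫ f :=
  box_hom_ext fun S T m a => by
    obtain ⟨a, rfl⟩ := (unitEquiv T).surjective a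
    rw [app_comp_elem, app_comp_elem, boxMap_boxMk, app_id_elem, boxRightUnitHom_boxMk,
      boxRightUnitHom_boxMk, app_map_elem]

lemma box_triangle (M N : Burnside G ⥤ AddCommGrpCat.{w}) [M.Additive] [N.Additive] :
    boxAssocHom M (unitFunctor.{w} G) N ≫ boxMap (𝟙 M) (boxLeftUnitHom N) =
      boxMap (boxRightUnitHom M) (𝟙 N) :=
  box_hom_ext₃ fun S T U m a n => by
    obtain ⟨a, rfl⟩ := (unitEquiv T).surjective a
    rw [app_comp_elem, boxAssocHom_boxMk, app_map_elem, boxMap_boxMk, boxMap_boxMk,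
      boxLeftUnitHom_boxMk, boxRightUnitHom_boxMk, app_id_elem, app_id_elem, boxMk_map_left,
      boxMk_map_right, map_comp_elem]
    congr 3
    simp

end Unit

/-! ### The symmetric monoidal category of Mackey functors -/

section Structure

variable [Finite G]

/-- The box product of Mackey functors. -/
def box (M N : Mackey.{w} G) : Mackey.{w} G := AdditiveFunctor.of (boxFunctor M.obj N.obj)

/-- The Burnside Green functor. -/
def unit (G : Type u) [Group G] [Finite G] : Mackey.{w} G := AdditiveFunctor.of (unitFunctor.{w} G)

instance : MonoidalCategoryStruct (Mackey.{w} G) where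
  tensorObj M N := box M N
  tensorHom φ ψ := ObjectProperty.homMk (boxMap φ.hom ψ.hom)
  whiskerLeft M _ _ ψ := ObjectProperty.homMk (boxMap (𝟙 M.obj) ψ.hom)
  whiskerRight φ N := ObjectProperty.homMk (boxMap φ.hom (𝟙 N.obj))
  tensorUnit := unit G
  associator M N P := ObjectProperty.isoMk _ (boxAssoc M.obj N.obj P.obj)
  leftUnitor M := ObjectProperty.isoMk _ (boxLeftUnit M.obj)
  rightUnitor M := ObjectProperty.isoMk _ (boxRightUnit M.obj)

lemma hom_ext' {M N : Mackey.{w} G} {φ ψ : M ⟶ N} (h : φ.hom = ψ.hom) : φ = ψ :=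
  InducedCategory.Hom.ext h

/-- Mackey functors form a monoidal category under the box product. -/
instance : MonoidalCategory (Mackey.{w} G) :=
  MonoidalCategory.ofTensorHom
    (id_tensorHom_id := fun M N => hom_ext' (box_hom_ext fun S T m n => boxMap_boxMk _ _ m n))
    (id_tensorHom := fun _ _ _ _ => rfl)
    (tensorHom_id := fun _ _ => rfl)
    (tensorHom_comp_tensorHom := fun f₁ f₂ g₁ g₂ => hom_ext' (box_hom_ext fun S T m n => by
      change (boxMap f₁.hom f₂.hom ≫ boxMap g₁.hom g₂.hom).app _ _ =
        (boxMap (f₁.hom ≫ g₁.hom) (f₂.hom ≫ g₂.hom)).app _ _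
      rw [app_comp_elem, boxMap_boxMk, boxMap_boxMk, boxMap_boxMk]; rfl))
    (associator_naturality := fun f₁ f₂ f₃ => hom_ext' (box_hom_ext₃ fun S T U m n p => by
      change (boxMap (boxMap f₁.hom f₂.hom) f₃.hom ≫ boxAssocHom _ _ _).app _ _ =
        (boxAssocHom _ _ _ ≫ boxMap f₁.hom (boxMap f₂.hom f₃.hom)).app _ _
      rw [app_comp_elem, app_comp_elem, boxMap_boxMk, boxMap_boxMk, boxAssocHom_boxMk,
        boxAssocHom_boxMk, app_map_elem, boxMap_boxMk, boxMap_boxMk]))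
    (leftUnitor_naturality := fun f => hom_ext' (boxLeftUnit_naturality f.hom))
    (rightUnitor_naturality := fun f => hom_ext' (boxRightUnit_naturality f.hom))
    (pentagon := fun M N P Q => hom_ext' (box_hom_ext₄ fun S T U V m n p q => by
      change (boxMap (boxAssocHom _ _ _) (𝟙 Q.obj) ≫ boxAssocHom _ _ _ ≫
        boxMap (𝟙 M.obj) (boxAssocHom _ _ _)).app _ _ = (boxAssocHom _ _ _ ≫ boxAssocHom _ _ _).app _ _
      rw [app_comp_elem, app_comp_elem, app_comp_elem, boxMap_boxMk, boxAssocHom_boxMk,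
        boxAssocHom_boxMk, boxMk_map_left, app_map_elem, app_map_elem, app_map_elem,
        boxAssocHom_boxMk, boxAssocHom_boxMk, app_map_elem, boxMap_boxMk, boxAssocHom_boxMk,
        app_id_elem, app_id_elem, boxMk_map_right]
      simp only [map_comp_elem]
      congr 3
      simp))
    (triangle := fun M N => hom_ext' (box_triangle M.obj N.obj))

/-- The box product of Mackey functors is symmetric. -/
instance : SymmetricCategory (Mackey.{w} G) where
  braiding M N := ObjectProperty.isoMk _ (boxSwap M.obj N.obj)
  braiding_naturality_right M N N' f := hom_ext' (box_hom_ext fun S T m n => by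
    change (boxMap (𝟙 M.obj) f.hom ≫ boxSwapHom _ _).app _ _ =
      (boxSwapHom _ _ ≫ boxMap f.hom (𝟙 M.obj)).app _ _
    rw [app_comp_elem, app_comp_elem, boxMap_boxMk, boxSwapHom_boxMk, boxSwapHom_boxMk,
      app_map_elem, boxMap_boxMk])
  braiding_naturality_left f N := hom_ext' (box_hom_ext fun S T m n => by
    change (boxMap f.hom (𝟙 N.obj) ≫ boxSwapHom _ _).app _ _ =
      (boxSwapHom _ _ ≫ boxMap (𝟙 N.obj) f.hom).app _ _
    rw [app_comp_elem, app_comp_elem, boxMap_boxMk, boxSwapHom_boxMk, boxSwapHom_boxMk,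
      app_map_elem, boxMap_boxMk])
  hexagon_forward M N P := hom_ext' (box_hom_ext₃ fun S T U m n p => by
    change (boxAssocHom _ _ _ ≫ boxSwapHom M.obj (boxFunctor N.obj P.obj) ≫ boxAssocHom _ _ _).app _ _ =
      (boxMap (boxSwapHom _ _) (𝟙 P.obj) ≫ boxAssocHom _ _ _ ≫
        boxMap (𝟙 N.obj) (boxSwapHom _ _)).app _ _
    rw [app_comp_elem, app_comp_elem, app_comp_elem, app_comp_elem, boxAssocHom_boxMk, app_map_elem,
      boxSwapHom_boxMk, boxMap_boxMk, boxSwapHom_boxMk, boxMk_map_left, app_map_elem, app_map_elem,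
      app_map_elem, app_map_elem, boxAssocHom_boxMk, boxAssocHom_boxMk, app_map_elem, boxMap_boxMk,
      boxSwapHom_boxMk, boxMk_map_right]
    simp only [map_comp_elem, app_id_elem]
    congr 3
    simpa only [Category.assoc] using BraidedCategory.hexagon_reverse T U S)
  hexagon_reverse M N P := hom_ext' (box_hom_ext₃' fun S T U m n p => by
    change (boxAssocInv _ _ _ ≫ boxSwapHom (boxFunctor M.obj N.obj) P.obj ≫ boxAssocInv _ _ _).app _ _ =
      (boxMap (𝟙 M.obj) (boxSwapHom _ _) ≫ boxAssocInv _ _ _ ≫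
        boxMap (boxSwapHom _ _) (𝟙 N.obj)).app _ _
    rw [app_comp_elem, app_comp_elem, app_comp_elem, app_comp_elem, boxAssocInv_boxMk, app_map_elem,
      boxSwapHom_boxMk, boxMap_boxMk, boxSwapHom_boxMk, boxMk_map_right, app_map_elem, app_map_elem,
      app_map_elem, app_map_elem, boxAssocInv_boxMk, boxAssocInv_boxMk, app_map_elem, boxMap_boxMk,
      boxSwapHom_boxMk, boxMk_map_left]
    simp only [map_comp_elem, app_id_elem]
    congr 3
    simpa only [Category.assoc] using BraidedCategory.hexagon_forward U S T)
  symmetry M N := hom_ext' (boxSwap M.obj N.obj).hom_inv_id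

end Structure

/-! ### The constant Green functor -/

section Constant

variable {S T U S' T' : Burnside G}

/-- The group of `G`-invariant functions `S → ℤ`. -/
def invFun (S : Burnside G) : AddSubgroup (S → ℤ) where
  carrier := {φ | ∀ (g : G) (s : S), φ (g • s) = φ s}
  zero_mem' := fun _ _ => rfl
  add_mem' := fun h k g s => congrArg₂ (· + ·) (h g s) (k g s)
  neg_mem' := fun h g s => congrArg Neg.neg (h g s)

lemma invFun_ext {φ ψ : invFun S} (h : ∀ s, φ.1 s = ψ.1 s) : φ = ψ := Subtype.ext (funext h)

/-- The function `t ↦ ∑ φ (l x)`, the sum over the points `x` with `r x = t`, for a diagram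
`S ← X → T` with legs `l` and `r`. -/
def fiberSum (X : Span S T) (φ : S → ℤ) (t : T) : ℤ :=
  ∑ᶠ (x : X.apex) (_ : X.r x = t), φ (X.l x)

lemma fiberSum_eq (X : Span S T) [Fintype X.apex] [DecidableEq T] (φ : S → ℤ) (t : T) :
    fiberSum X φ t = ∑ x, if X.r x = t then φ (X.l x) else 0 := by
  rw [fiberSum, finsum_eq_sum_of_fintype]
  refine Finset.sum_congr rfl fun x _ => ?_
  rw [finsum_eq_if]

lemma fiberSum_iso {X Y : Span S T} (h : Span.Iso X Y) (φ : S → ℤ) : fiberSum X φ = fiberSum Y φ := by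
  obtain ⟨e, -, hl, hr⟩ := h
  funext t
  classical
  let _ := Fintype.ofFinite X.apex
  let _ := Fintype.ofFinite Y.apex
  rw [fiberSum_eq, fiberSum_eq]
  exact Fintype.sum_equiv e _ _ fun x => by rw [hl, hr]

lemma fiberSum_smul (X : Span S T) (φ : invFun S) (g : G) (t : T) :
    fiberSum X φ.1 (g • t) = fiberSum X φ.1 t := by
  classical
  let _ := Fintype.ofFinite X.apex
  rw [fiberSum_eq, fiberSum_eq]
  refine (Fintype.sum_equiv (MulAction.toPerm g) _ _ fun x => ?_).symm
  rw [MulAction.toPerm_apply, map_smul, map_smul, φ.2]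
  simp

/-- The action of a diagram on invariant functions. -/
def spanAct (X : Span S T) : invFun S →+ invFun T :=
  AddMonoidHom.mk' (fun φ => ⟨fiberSum X φ.1, fun g t => fiberSum_smul X φ g t⟩) fun φ ψ => by
    refine invFun_ext fun t => ?_
    classical
    let _ := Fintype.ofFinite X.apex
    change fiberSum X (φ.1 + ψ.1) t = fiberSum X φ.1 t + fiberSum X ψ.1 t
    rw [fiberSum_eq, fiberSum_eq, fiberSum_eq, ← Finset.sum_add_distrib]
    refine Finset.sum_congr rfl fun x _ => ?_
    split_ifs <;> simp

/-- The action of the morphisms of the Burnside category on invariant functions. -/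
def homAct (S T : Burnside G) : (S ⟶ T) →+ invFun S →+ invFun T :=
  Mor.lift (fun X => spanAct X)
    (fun X Y h => by ext φ : 1; exact Subtype.ext (fiberSum_iso h φ.1))
    (by
      ext φ : 1
      refine invFun_ext fun t => ?_
      change fiberSum (Span.empty S T) φ.1 t = 0
      exact finsum_of_isEmpty (α := PEmpty) _)
    (fun X Y => by
      ext φ : 1
      refine invFun_ext fun t => ?_
      classical
      let _ := Fintype.ofFinite X.apex
      let _ := Fintype.ofFinite Y.apex
      let _ : Fintype (X.coprod Y).apex := inferInstanceAs (Fintype (X.apex ⊕ Y.apex))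
      change fiberSum (X.coprod Y) φ.1 t = fiberSum X φ.1 t + fiberSum Y φ.1 t
      rw [fiberSum_eq, fiberSum_eq, fiberSum_eq]
      exact Fintype.sum_sum_type _)

lemma homAct_homOf (X : Span S T) (φ : invFun S) (t : T) :
    (homAct S T (homOf X) φ).1 t = fiberSum X φ.1 t :=
  congrArg (fun a : invFun S →+ invFun T => (a φ).1 t) (Mor.lift_ofSpan _ _ _ _ X)

lemma homAct_pull (f : S →[G] T) (φ : invFun T) (s : S) :
    (homAct T S (pull f) φ).1 s = φ.1 (f s) := by
  rw [pull, homAct_homOf]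
  classical
  let _ := Fintype.ofFinite S
  let _ : Fintype (Span.pull f).apex := inferInstanceAs (Fintype S)
  rw [fiberSum_eq]
  change ∑ x : S, (if x = s then φ.1 (f x) else 0) = _
  simp

lemma homAct_id (φ : invFun S) : homAct S S (𝟙 S) φ = φ :=
  invFun_ext fun s => homAct_pull (MulActionHom.id G) φ s

lemma homAct_comp (a : S ⟶ T) (b : T ⟶ U) (φ : invFun S) :
    homAct S U (a ≫ b) φ = homAct T U b (homAct S T a φ) := by
  induction a using hom_induction with
  | sub a₁ a₂ h₁ h₂ =>
    rw [Preadditive.sub_comp, map_sub, map_sub, AddMonoidHom.sub_apply, AddMonoidHom.sub_apply,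
      map_sub, h₁, h₂]
  | of X =>
    induction b using hom_induction with
    | sub a₁ a₂ h₁ h₂ =>
      rw [Preadditive.comp_sub, map_sub, map_sub, AddMonoidHom.sub_apply, AddMonoidHom.sub_apply,
        h₁, h₂]
    | of Y =>
      refine invFun_ext fun u => ?_
      rw [homOf_comp, homAct_homOf, homAct_homOf]
      classical
      let _ := Fintype.ofFinite X.apex
      let _ := Fintype.ofFinite Y.apex
      let _ : Fintype (X.comp Y).apex := inferInstanceAs (Fintype (Span.PullbackType X Y))
      rw [fiberSum_eq, fiberSum_eq]
      simp only [homAct_homOf, fiberSum_eq]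
      change ∑ p : {p : X.apex × Y.apex // X.r p.1 = Y.l p.2},
        (if Y.r p.1.2 = u then φ.1 (X.l p.1.1) else 0) = _
      rw [← Finset.sum_subtype (p := fun p : X.apex × Y.apex => X.r p.1 = Y.l p.2)
        (Finset.univ.filter fun p : X.apex × Y.apex => X.r p.1 = Y.l p.2) (by simp)
        (fun p => if Y.r p.2 = u then φ.1 (X.l p.1) else 0), Finset.sum_filter,
        Fintype.sum_prod_type_right]
      refine Finset.sum_congr rfl fun y _ => ?_
      split_ifs with h <;> simp

/-- The external product of invariant functions. -/
def extMul (S T : Burnside G) : invFun S →+ invFun T →+ invFun (S ⊗ T) :=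
  AddMonoidHom.mk' (fun φ => AddMonoidHom.mk'
      (fun ψ => ⟨fun p : S × T => φ.1 p.1 * ψ.1 p.2, fun g p => by
        change φ.1 (g • p.1) * ψ.1 (g • p.2) = _
        rw [φ.2, ψ.2]⟩)
      fun ψ ψ' => invFun_ext fun p => mul_add _ _ _)
    fun φ φ' => by ext ψ : 1; exact invFun_ext fun p => add_mul _ _ _

lemma extMul_apply (φ : invFun S) (ψ : invFun T) (p : S × T) :
    (extMul S T φ ψ).1 p = φ.1 p.1 * ψ.1 p.2 := rfl

lemma homAct_tensor (a : S ⟶ S') (b : T ⟶ T') (φ : invFun S) (ψ : invFun T) :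
    homAct _ _ (a ⊗ₘ b) (extMul S T φ ψ) = extMul S' T' (homAct _ _ a φ) (homAct _ _ b ψ) := by
  induction a using hom_induction with
  | sub a₁ a₂ h₁ h₂ =>
    change homAct _ _ (prodMap _ _) _ = _
    rw [prodMap_sub_left, map_sub, map_sub, AddMonoidHom.sub_apply, AddMonoidHom.sub_apply,
      map_sub, AddMonoidHom.sub_apply]
    exact congrArg₂ _ h₁ h₂
  | of X =>
    induction b using hom_induction with
    | sub a₁ a₂ h₁ h₂ =>
      change homAct _ _ (prodMap _ _) _ = _
      rw [prodMap_sub_right, map_sub, map_sub, AddMonoidHom.sub_apply, AddMonoidHom.sub_apply,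
        map_sub]
      exact congrArg₂ _ h₁ h₂
    | of Y =>
      refine invFun_ext fun p => ?_
      refine (congrArg (fun z => (homAct _ _ z (extMul S T φ ψ)).1 p) (prodMap_homOf X Y)).trans ?_
      refine (homAct_homOf _ _ _).trans ?_
      change _ = (homAct _ _ (homOf X) φ).1 p.1 * (homAct _ _ (homOf Y) ψ).1 p.2
      rw [homAct_homOf, homAct_homOf]
      classical
      let _ := Fintype.ofFinite X.apex
      let _ := Fintype.ofFinite Y.apex
      let _ : Fintype (X.prod Y).apex := inferInstanceAs (Fintype (X.apex × Y.apex))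
      rw [fiberSum_eq, fiberSum_eq, fiberSum_eq, Fintype.sum_mul_sum]
      refine (Fintype.sum_prod_type (α₁ := X.apex) (α₂ := Y.apex) _).trans ?_
      refine Finset.sum_congr rfl fun x _ => Finset.sum_congr rfl fun y _ => ?_
      have key : (X.prod Y).r (x, y) = p ↔ X.r x = p.1 ∧ Y.r y = p.2 := Prod.ext_iff
      have key' : (extMul S T φ ψ).1 ((X.prod Y).l (x, y)) = φ.1 (X.l x) * ψ.1 (Y.l y) := rfl
      rw [key']
      simp only [key]
      split_ifs <;> simp_all

/-- The constant function `1`. -/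
def oneFun (S : Burnside G) : invFun S := ⟨1, fun _ _ => rfl⟩

variable [Finite G]

/-- The functor underlying the constant Green functor. It sends `S` to the group of invariant
functions `S → ℤ`; for an orbit this group is `ℤ`, restrictions are identities and
transfers are multiplications by the index. -/
def constFunctor (G : Type u) [Group G] [Finite G] : Burnside G ⥤ AddCommGrpCat.{w} where
  obj S := AddCommGrpCat.of (Shrink.{w} (invFun S))
  map {S T} f := AddCommGrpCat.ofHom (AddMonoidHom.mk' (fun φ => equivShrink _
    (homAct S T f ((equivShrink _).symm φ))) fun a b => by simp)
  map_id S := by ext φ; simp [homAct_id]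
  map_comp f g := by ext φ; simp [homAct_comp]

/-- The elements of the constant Green functor at `S` are the invariant functions. -/
def constEquiv (S : Burnside G) : invFun S ≃+ (constFunctor.{w} G).obj S := Shrink.addEquiv.symm

lemma constFunctor_map (f : S ⟶ T) (φ : invFun S) :
    (constFunctor.{w} G).map f (constEquiv S φ) = constEquiv T (homAct S T f φ) :=
  congrArg (fun x => equivShrink.{w} (invFun T) (homAct S T f x)) ((equivShrink _).symm_apply_apply φ)

instance : (constFunctor.{w} G).Additive where
  map_add {S T f g} := by
    ext φ
    obtain ⟨φ, rfl⟩ := (constEquiv S).surjective φ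
    change (constFunctor.{w} G).map (f + g) _ =
      (constFunctor.{w} G).map f _ + (constFunctor.{w} G).map g _
    rw [constFunctor_map, constFunctor_map, constFunctor_map, map_add, AddMonoidHom.add_apply,
      map_add]

/-- The unit of the constant Green functor: it sends the identity of the point to the constant
function `1`. -/
def constOne (G : Type u) [Group G] [Finite G] : unitFunctor.{w} G ⟶ constFunctor.{w} G where
  app S := AddCommGrpCat.ofHom ((constEquiv S).toAddMonoidHom.comp
    (((homAct _ S).flip (oneFun (point G))).comp (unitEquiv S).symm.toAddMonoidHom))
  naturality S T f := by
    ext a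
    obtain ⟨a, rfl⟩ := (unitEquiv S).surjective a
    change constEquiv T (homAct _ T ((unitEquiv T).symm ((unitFunctor G).map f (unitEquiv S a))) _) =
      (constFunctor G).map f (constEquiv S (homAct _ S ((unitEquiv S).symm (unitEquiv S a)) _))
    rw [unitFunctor_map, AddEquiv.symm_apply_apply, AddEquiv.symm_apply_apply, constFunctor_map]
    exact congrArg _ (homAct_comp _ _ _)

lemma constOne_app (a : 𝟙_ (Burnside G) ⟶ S) :
    (constOne.{w} G).app S (unitEquiv S a) = constEquiv S (homAct _ S a (oneFun (point G))) := by
  change constEquiv S (homAct _ S ((unitEquiv S).symm (unitEquiv S a)) _) = _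
  rw [AddEquiv.symm_apply_apply]

/-- The multiplication of the constant Green functor: the multiplication of integer functions. -/
def constMul (G : Type u) [Group G] [Finite G] :
    boxFunctor (constFunctor.{w} G) (constFunctor.{w} G) ⟶ constFunctor.{w} G :=
  boxDesc
    { app := fun S T => (((extMul S T).comp (constEquiv S).symm.toAddMonoidHom).compr₂
          (constEquiv (S ⊗ T)).toAddMonoidHom).compl₂ (constEquiv T).symm.toAddMonoidHom
      natural := fun {S S' T T'} f g φ ψ => by
        obtain ⟨φ, rfl⟩ := (constEquiv S).surjective φ
        obtain ⟨ψ, rfl⟩ := (constEquiv T).surjective ψ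
        change (constFunctor G).map (f ⊗ₘ g) (constEquiv _ (extMul S T ((constEquiv S).symm _)
          ((constEquiv T).symm _))) = constEquiv _ (extMul S' T' ((constEquiv S').symm _)
          ((constEquiv T').symm _))
        rw [constFunctor_map, constFunctor_map, constFunctor_map]
        simp only [AddEquiv.symm_apply_apply]
        rw [homAct_tensor] }

lemma constMul_boxMk (φ : invFun S) (ψ : invFun T) :
    (constMul.{w} G).app (S ⊗ T) (boxMk _ _ S T (constEquiv S φ) (constEquiv T ψ)) =
      constEquiv (S ⊗ T) (extMul S T φ ψ) := by
  refine (boxDesc_boxMk _ _ _).trans ?_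
  change constEquiv _ (extMul S T ((constEquiv S).symm _) ((constEquiv T).symm _)) = _
  simp only [AddEquiv.symm_apply_apply]

lemma leftUnit_inv_eq_pull (S : Burnside G) : (λ_ S).inv = pull (sndMap (point G) S) :=
  push_eq_pull _ _ (fun _ => rfl) (fun _ => rfl)

lemma rightUnit_inv_eq_pull (S : Burnside G) : (ρ_ S).inv = pull (fstMap S (point G)) :=
  push_eq_pull _ _ (fun _ => rfl) (fun _ => rfl)

lemma assoc_inv_eq_pull (S T U : Burnside G) : (α_ S T U).inv = pull (assocMap S T U) :=
  push_eq_pull _ _ (fun _ => rfl) (fun _ => rfl)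

lemma const_one_mul : boxMap (constOne.{w} G) (𝟙 _) ≫ constMul.{w} G = boxLeftUnitHom _ :=
  box_hom_ext fun S T a φ => by
    obtain ⟨a, rfl⟩ := (unitEquiv S).surjective a
    obtain ⟨φ, rfl⟩ := (constEquiv T).surjective φ
    rw [app_comp_elem, boxMap_boxMk, boxLeftUnitHom_boxMk, constOne_app, app_id_elem,
      constMul_boxMk, constFunctor_map]
    congr 1
    have : homAct T (𝟙_ _ ⊗ T) (λ_ T).inv φ = extMul (𝟙_ _) T (oneFun (point G)) φ := by
      refine invFun_ext fun p => ?_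
      rw [leftUnit_inv_eq_pull]
      exact (homAct_pull _ _ _).trans (one_mul _).symm
    rw [homAct_comp, this, ← tensorHom_id, homAct_tensor, homAct_id]

lemma const_mul_one : boxMap (𝟙 _) (constOne.{w} G) ≫ constMul.{w} G = boxRightUnitHom _ :=
  box_hom_ext fun S T φ a => by
    obtain ⟨a, rfl⟩ := (unitEquiv T).surjective a
    obtain ⟨φ, rfl⟩ := (constEquiv S).surjective φ
    rw [app_comp_elem, boxMap_boxMk, boxRightUnitHom_boxMk, constOne_app, app_id_elem,
      constMul_boxMk, constFunctor_map]
    congr 1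
    have : homAct S (S ⊗ 𝟙_ _) (ρ_ S).inv φ = extMul S (𝟙_ _) φ (oneFun (point G)) := by
      refine invFun_ext fun p => ?_
      rw [rightUnit_inv_eq_pull]
      exact (homAct_pull _ _ _).trans (mul_one _).symm
    rw [homAct_comp, this, ← id_tensorHom, homAct_tensor, homAct_id]

lemma const_mul_assoc : boxMap (constMul.{w} G) (𝟙 _) ≫ constMul.{w} G =
    boxAssocHom _ _ _ ≫ boxMap (𝟙 _) (constMul.{w} G) ≫ constMul.{w} G :=
  box_hom_ext₃ fun S T U φ ψ χ => by
    obtain ⟨φ, rfl⟩ := (constEquiv S).surjective φ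
    obtain ⟨ψ, rfl⟩ := (constEquiv T).surjective ψ
    obtain ⟨χ, rfl⟩ := (constEquiv U).surjective χ
    rw [app_comp_elem, app_comp_elem, app_comp_elem, boxMap_boxMk, constMul_boxMk, app_id_elem,
      constMul_boxMk, boxAssocHom_boxMk, app_map_elem, boxMap_boxMk, app_map_elem, app_id_elem,
      constMul_boxMk, constMul_boxMk, constFunctor_map]
    congr 1
    refine invFun_ext fun p => ?_
    rw [assoc_inv_eq_pull]
    exact (mul_assoc _ _ _).trans
      (homAct_pull (assocMap S T U) (extMul S (T ⊗ U) φ (extMul T U ψ χ)) p).symm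

lemma const_mul_comm : boxSwapHom _ _ ≫ constMul.{w} G = constMul.{w} G :=
  box_hom_ext fun S T φ ψ => by
    obtain ⟨φ, rfl⟩ := (constEquiv S).surjective φ
    obtain ⟨ψ, rfl⟩ := (constEquiv T).surjective ψ
    rw [app_comp_elem, boxSwapHom_boxMk, app_map_elem, constMul_boxMk, constMul_boxMk,
      constFunctor_map]
    congr 1
    refine invFun_ext fun p => ?_
    have : (β_ T S).hom = pull (swapMap S T) := swap_hom_eq_pull
    rw [this]
    exact (homAct_pull _ _ _).trans (mul_comm _ _)

/-- The Mackey functor underlying the constant Green functor. -/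
def const (G : Type u) [Group G] [Finite G] : Mackey.{w} G := AdditiveFunctor.of (constFunctor.{w} G)

instance : MonObj (const.{w} G) where
  one := ObjectProperty.homMk (constOne.{w} G)
  mul := ObjectProperty.homMk (constMul.{w} G)
  one_mul := hom_ext' const_one_mul
  mul_one := hom_ext' const_mul_one
  mul_assoc := hom_ext' const_mul_assoc

instance : IsCommMonObj (const.{w} G) where
  mul_comm := hom_ext' const_mul_comm

end Constant

/-! ### Green functors and modules -/

/-- Green functors: commutative monoids for the box product. -/
abbrev Green (G : Type u) [Group G] [Finite G] := CommMon (Mackey.{w} G)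

/-- The category of modules over a Green functor. -/
abbrev Green.Modules {G : Type u} [Group G] [Finite G] (R : Green.{w} G) := Mod (Mackey.{w} G) R.X

/-- The constant Green functor `ℤ`. -/
def constantGreen (G : Type u) [Group G] [Finite G] : Green.{w} G := ⟨const G⟩

/-- A `G`-map `G / H → G / K` exists only if the order of `H` divides the order of `K`. -/
lemma card_dvd_card_of_orbitMap [Finite G] {H K : Subgroup G} (f : orbit H →[G] orbit K) :
    Nat.card H ∣ Nat.card K := by
  obtain ⟨g, hg⟩ := QuotientGroup.mk_surjective (s := K) (f (QuotientGroup.mk (s := H) 1))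
  have key : ∀ h ∈ H, g⁻¹ * h * g ∈ K := fun h hh => by
    have h₁ : h • (QuotientGroup.mk (s := H) 1 : G ⧸ H) = QuotientGroup.mk (s := H) 1 :=
      QuotientGroup.eq.2 (by simpa using H.inv_mem hh)
    have h₂ : h • (QuotientGroup.mk (s := K) g : G ⧸ K) = QuotientGroup.mk (s := K) g := by
      rw [hg]
      exact (map_smul f h _).symm.trans (congrArg f h₁)
    have h₃ := QuotientGroup.eq.1 h₂.symm
    simpa [mul_assoc] using h₃
  refine Subgroup.card_dvd_of_injective
    (⟨⟨fun h => ⟨g⁻¹ * h.1 * g, key h.1 h.2⟩, by simp⟩, fun a b => by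
      apply Subtype.ext; simp [mul_assoc]⟩ : H →* K) fun a b h => ?_
  have := congrArg Subtype.val h
  exact Subtype.ext (by simpa using this)

/-- The Mackey functors `M` such that `f_* f^*` is multiplication by `|K| / |H|` for every `G`-map
`f : G / H → G / K`. -/
def indexCondition (G : Type u) [Group G] [Finite G] : ObjectProperty (Mackey.{w} G) := fun M =>
  ∀ (H K : Subgroup G) (f : orbit H →[G] orbit K) (x : M.obj.obj (orbit K)),
    M.obj.map (push f) (M.obj.map (pull f) x) = (Nat.card K / Nat.card H) • x

end Mackey

end

noncomputable section

namespace Burnside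

/-! ### Decomposition of diagrams into orbits -/

variable {G : Type u} [Group G] {S T U : Burnside G}

/-! Every Mackey functor is a module over the Burnside ring functor `S ↦ Hom(pt, S)` in exactly one
way, and the unit of the constant Green functor is the map `degree`, which sends a class `[X → S]`
to the function counting the points of its fibres. The theorem rests on two facts: `degree` is
surjective, and the index condition is precisely what makes its kernel act by zero.

Surjectivity (`degree_ofFun`) holds because the indicator function of an orbit of `S` is the degree
of the inclusion of that orbit. The unit axiom then forces the action of `degree a` to be the action
of `a` (`actMap_boxMk`), so a Mackey functor carries at most one module structure and every morphism
of Mackey functors between modules is linear (`actMap_naturality`). Hence the forgetful functor is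
fully faithful.

For the kernel, the key computation is that multiplication by a class `[f : X → S]` on `M(S)` is the
composite `f_* f^*` (`mulEnd_homOf`, `mulEnd_push`). For `f : G/H → G/K` the degree of `[f]` is the
constant function `|K|/|H|` (`homAct_push_orbit`), while the identity of `G/K` has degree `1`. In a
module these two classes must therefore act as `|K|/|H|` and as `1`, which is the index condition
(`indexCondition_of_module`).

Conversely, let `M` satisfy the index condition. Classes of diagrams with apex an orbit generate,
and a map `G/H → S` factors through the inclusion `G/K → S` of an orbit; the index condition
replaces `[G/H → S]` by `|K|/|H|` times `[G/K → S]`. So multiplication by `a` depends on `degree a`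
only: internally by `map_mulEnd_ofFun`, then externally by `map_extEnd_congr`, because an external
product is a restriction followed by an internal multiplication (`extEnd_eq`). The action thus
descends to the constant Green functor, and the module axioms follow from those of the Burnside ring
functor. -/

/-- The `G`-subset of a finite `G`-set given by an invariant predicate. -/
def subset (X : Burnside G) (P : X → Prop) (h : ∀ (g : G) x, P x → P (g • x)) : Burnside G where
  carrier := {x // P x}
  action :=
    { smul := fun g x => ⟨g • x.1, h g x.1 x.2⟩
      one_smul := fun x => Subtype.ext (one_smul G x.1)
      mul_smul := fun g g' x => Subtype.ext (mul_smul g g' x.1) }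

/-- The restriction of a diagram `S ← X → T` to an invariant subset of `X`. -/
def Span.restrict (X : Span S T) (P : X.apex → Prop) (h : ∀ (g : G) x, P x → P (g • x)) :
    Span S T where
  apex := X.apex.subset P h
  l := ⟨fun x => X.l x.1, fun g x => map_smul X.l g x.1⟩
  r := ⟨fun x => X.r x.1, fun g x => map_smul X.r g x.1⟩

lemma Span.restrict_coprod_restrict_not (X : Span S T) (P : X.apex → Prop)
    (h : ∀ (g : G) x, P x → P (g • x)) (h' : ∀ (g : G) x, ¬ P x → ¬ P (g • x)) :
    Iso ((X.restrict P h).coprod (X.restrict (fun x => ¬ P x) h')) X := by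
  classical
  refine ⟨Equiv.sumCompl P, ?_, ?_, ?_⟩
  · rintro g (x | x) <;> rfl
  · rintro (x | x) <;> rfl
  · rintro (x | x) <;> rfl

lemma homOf_eq_zero (X : Span S T) [IsEmpty X.apex] : homOf X = 0 :=
  (homOf_eq (Y := Span.empty S T) ⟨Equiv.equivPEmpty _, fun _ x => isEmptyElim x,
    fun x => isEmptyElim x, fun x => isEmptyElim x⟩).trans ofSpan_empty

/-- The `G`-map from a finite `G`-set to the point. -/
def toPoint (X : Burnside G) : X →[G] point G := ⟨fun _ => PUnit.unit, fun _ _ => rfl⟩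

/-- The left side is the form in which the class of `f` in the Burnside ring functor at `T` is
written from here on. -/
lemma pull_toPoint_push (f : S →[G] T) :
    pull (toPoint S) ≫ push f = homOf ⟨S, toPoint S, f⟩ :=
  homOf_comp_push (Span.pull (toPoint S)) f

lemma pull_push_self (f : S →[G] T) : pull f ≫ push f = homOf ⟨S, f, f⟩ :=
  homOf_comp_push (Span.pull f) f

section Finite

variable [Finite G]

/-- The orbit of a point `s` of `S`, as a `G`-map `G / Gₛ → S`. -/
def orbitMap (s : S) : orbit (MulAction.stabilizer G s) →[G] S :=
  ⟨MulAction.ofQuotientStabilizer G s, fun g x => MulAction.ofQuotientStabilizer_smul G s g x⟩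

lemma orbitMap_injective (s : S) : Function.Injective (orbitMap s) :=
  MulAction.injective_ofQuotientStabilizer G s

/-- Every morphism of the Burnside category is a combination of diagrams `S ← G / H → T`. -/
lemma hom_induction_orbit {p : (S ⟶ T) → Prop}
    (orbit : ∀ (H : Subgroup G) (l : orbit H →[G] S) (r : Burnside.orbit H →[G] T),
      p (homOf ⟨Burnside.orbit H, l, r⟩))
    (zero : p 0) (add : ∀ a b, p a → p b → p (a + b)) (sub : ∀ a b, p a → p b → p (a - b))
    (a : S ⟶ T) : p a := by
  induction a using hom_induction with
  | sub a b ha hb => exact sub a b ha hb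
  | of X =>
    -- Induction on the size of the apex: one orbit is split off and the complement, again a
    -- `G`-set, is smaller.
    induction hn : Nat.card X.apex using Nat.strong_induction_on generalizing X with
    | _ n ih =>
      rcases isEmpty_or_nonempty X.apex with hX | ⟨⟨x⟩⟩
      · rwa [homOf_eq_zero X]
      · have h : ∀ (g : G) y, y ∈ MulAction.orbit G x → g • y ∈ MulAction.orbit G x := by
          rintro g _ ⟨k, rfl⟩
          exact ⟨g * k, mul_smul g k x⟩
        have h' : ∀ (g : G) y, ¬ y ∈ MulAction.orbit G x → ¬ g • y ∈ MulAction.orbit G x :=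
          fun g y hy hy' => hy (by simpa using h g⁻¹ _ hy')
        rw [← homOf_eq (X.restrict_coprod_restrict_not _ h h')]
        refine (congrArg p (ofSpan_coprod _ _)).mpr (add _ _ ?_ ?_)
        · have := orbit (MulAction.stabilizer G x) (X.l.comp (orbitMap x)) (X.r.comp (orbitMap x))
          refine (congrArg p (homOf_eq ?_)).mp this
          -- The orbit of `x` is the quotient by the stabilizer of `x`, so this summand is one of
          -- the diagrams covered by `orbit`.
          refine ⟨(MulAction.orbitEquivQuotientStabilizer G x).symm, ?_, ?_, ?_⟩
          · rintro g ⟨y⟩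
            exact Subtype.ext (mul_smul g y x)
          · rintro ⟨y⟩; rfl
          · rintro ⟨y⟩; rfl
        · refine ih _ ?_ _ rfl
          rw [← hn]
          -- The complement of the orbit misses `x`, so it has strictly fewer elements.
          exact Finite.card_subtype_lt (x := x) (not_not.2 (MulAction.mem_orbit_self x))

end Finite

/-! ### Multiplication by an element of the Burnside ring functor -/

/-- The diagonal `S → S × S`. -/
def diagMap (S : Burnside G) : S →[G] S.prod S := ⟨fun s => (s, s), fun _ _ => rfl⟩

/-- External multiplication by `a : pt ⟶ S`. -/
def extEnd (T : Burnside G) : (𝟙_ (Burnside G) ⟶ S) →+ (T ⟶ S ⊗ T) :=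
  AddMonoidHom.mk' (fun a => (λ_ T).inv ≫ a ▷ T) fun a b => by
    rw [MonoidalPreadditive.add_whiskerRight, Preadditive.comp_add]

lemma extEnd_apply (a : 𝟙_ (Burnside G) ⟶ S) (T : Burnside G) :
    extEnd T a = (λ_ T).inv ≫ a ▷ T := rfl

/-- Internal multiplication by `a : pt ⟶ S`, an endomorphism of `S`. -/
def mulEnd (S : Burnside G) : (𝟙_ (Burnside G) ⟶ S) →+ (S ⟶ S) :=
  AddMonoidHom.mk' (fun a => extEnd S a ≫ pull (diagMap S)) fun a b => by
    rw [map_add, Preadditive.add_comp]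

lemma mulEnd_apply (a : 𝟙_ (Burnside G) ⟶ S) :
    mulEnd S a = extEnd S a ≫ pull (diagMap S) := rfl

lemma extEnd_homOf (X : Span (point G) S) (T : Burnside G) : extEnd T (homOf X) =
    homOf ⟨X.apex.prod T, sndMap _ _, mapProd X.r (MulActionHom.id G)⟩ := by
  have h : (λ_ T).inv = pull (sndMap (point G) T) :=
    push_eq_pull _ _ (fun _ => rfl) (fun _ => rfl)
  rw [extEnd_apply, h]
  change pull _ ≫ prodMap (homOf X) (homOf (Span.push (MulActionHom.id G))) = _
  rw [prodMap_homOf, pull_comp_homOf]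
  rfl

/-- The external product is `S ← X × S → S × S`; pulling it back along the diagonal leaves the graph
of `X → S`, which is a copy of `X`. This is Frobenius reciprocity: multiplying by a transferred `1`
is restriction followed by transfer. -/
lemma mulEnd_homOf (X : Span (point G) S) : mulEnd S (homOf X) = homOf ⟨X.apex, X.r, X.r⟩ := by
  rw [mulEnd_apply, extEnd_homOf]
  refine (homOf_comp _ _).trans (homOf_eq ?_)
  have key : ∀ p : Span.PullbackType
      (⟨X.apex.prod S, sndMap _ _, mapProd X.r (MulActionHom.id G)⟩ : Span S (S.prod S))
      (Span.pull (diagMap S)), X.r p.1.1.1 = p.1.2 ∧ p.1.1.2 = p.1.2 := fun p => Prod.ext_iff.1 p.2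
  refine ⟨⟨fun p => p.1.1.1, fun x => ⟨((x, X.r x), X.r x), rfl⟩, fun p => ?_, fun _ => rfl⟩,
    fun _ _ => rfl, fun p => (key p).1.trans (key p).2.symm, fun p => (key p).1⟩
  exact Subtype.ext (Prod.ext (Prod.ext rfl ((key p).1.trans (key p).2.symm)) (key p).1)

/-- The bridge between the two sides of the theorem: the operator `f_* f^*` of the index condition
is multiplication by a class of the Burnside ring functor. -/
lemma mulEnd_push (f : S →[G] T) : mulEnd T (pull (toPoint S) ≫ push f) = pull f ≫ push f := by
  rw [pull_toPoint_push, pull_push_self, mulEnd_homOf]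

/-- An external product is recovered from internal ones: `a × m` is the product, over `S × T`, of
the restrictions of `a` and `m` along the two projections. On diagrams it holds because the pullback
of `X → S` along `S × T → S` is `X × T`. -/
lemma extEnd_eq (a : 𝟙_ (Burnside G) ⟶ S) (T : Burnside G) :
    extEnd T a = pull (sndMap S T) ≫ mulEnd (S ⊗ T) (a ≫ pull (fstMap S T)) := by
  induction a using hom_induction with
  | sub a b ha hb => rw [map_sub, Preadditive.sub_comp, map_sub, Preadditive.comp_sub, ha, hb]
  | of X =>
    have h : homOf X ≫ pull (fstMap S T) = homOf (X.comp (Span.pull (fstMap S T))) :=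
      homOf_comp _ _
    rw [extEnd_homOf, h, mulEnd_homOf]
    refine (homOf_eq ?_).trans (pull_comp_homOf (sndMap S T) _).symm
    refine ⟨⟨fun p => ⟨(p.1, (X.r p.1, p.2)), rfl⟩, fun p => (p.1.1, p.1.2.2), fun _ => rfl,
      fun p => Subtype.ext (Prod.ext rfl (Prod.ext p.2 rfl))⟩, fun g p => ?_, fun _ => rfl,
      fun _ => rfl⟩
    exact Subtype.ext (Prod.ext rfl (Prod.ext (map_smul X.r g p.1) rfl))

/-- Naturality of the external product in both variables, from the interchange law; it gives the
naturality of the pairing in `constPairing`. -/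
lemma extEnd_tensorHom (a : 𝟙_ (Burnside G) ⟶ S) {S' T' : Burnside G} (f : S ⟶ S') (g : T ⟶ T') :
    extEnd T a ≫ (f ⊗ₘ g) = g ≫ extEnd T' (a ≫ f) := by
  simp only [extEnd_apply, MonoidalCategory.tensorHom_def, comp_whiskerRight, Category.assoc]
  rw [leftUnitor_inv_naturality_assoc, whisker_exchange_assoc, whisker_exchange]

/-- Since `b ≫ extEnd T a` is the external product of `a` and `b`, this is the associativity of the
action of the Burnside ring functor. -/
lemma extEnd_extEnd (a : 𝟙_ (Burnside G) ⟶ S) (b : 𝟙_ (Burnside G) ⟶ T) (U : Burnside G) :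
    extEnd U (b ≫ extEnd T a) = extEnd U b ≫ extEnd (T ⊗ U) a ≫ (α_ S T U).inv := by
  simp only [extEnd_apply, comp_whiskerRight, Category.assoc, leftUnitor_inv_naturality_assoc]
  simp

end Burnside

namespace Mackey

open Burnside

variable {G : Type u} [Group G] {S T U : Burnside G}

/-! ### Invariant functions represented by morphisms from the point -/

lemma homAct_pull_oneFun (f : S →[G] T) : homAct T S (pull f) (oneFun T) = oneFun S :=
  invFun_ext fun s => homAct_pull f (oneFun T) s

/-- The invariant function on `S` represented by a morphism `pt ⟶ S`. -/
def degree (S : Burnside G) : (𝟙_ (Burnside G) ⟶ S) →+ invFun S :=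
  (homAct _ S).flip (oneFun (point G))

lemma degree_comp (a : 𝟙_ (Burnside G) ⟶ S) (f : S ⟶ T) :
    degree T (a ≫ f) = homAct S T f (degree S a) := homAct_comp a f _

lemma degree_toPoint : degree S (pull (toPoint S)) = oneFun S := homAct_pull_oneFun _

/-- The degree is multiplicative. The external multiplication of functions is natural for all
morphisms of the Burnside category, so `a ▷ T` may be applied to the product of the constant
function `1` on the point with `degree T b`. -/
lemma degree_comp_extEnd (a : 𝟙_ (Burnside G) ⟶ S) (b : 𝟙_ (Burnside G) ⟶ T) :
    degree (S ⊗ T) (b ≫ extEnd T a) = extMul S T (degree S a) (degree T b) := by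
  have h : homAct T (𝟙_ _ ⊗ T) (λ_ T).inv (degree T b) =
      extMul (𝟙_ _) T (oneFun (point G)) (degree T b) := by
    refine invFun_ext fun p => ?_
    have h' : (λ_ T).inv = pull (sndMap (point G) T) :=
      push_eq_pull _ _ (fun _ => rfl) (fun _ => rfl)
    rw [h']
    exact (homAct_pull _ _ _).trans (one_mul _).symm
  rw [degree_comp, extEnd_apply, homAct_comp, h, ← tensorHom_id, homAct_tensor, homAct_id]
  rfl

lemma homAct_push [Fintype S] [DecidableEq T] (f : S →[G] T) (φ : invFun S) (t : T) :
    (homAct S T (push f) φ).1 t = ∑ s, if f s = t then φ.1 s else 0 := by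
  let _ : Fintype (Span.push f).apex := inferInstanceAs (Fintype S)
  exact (homAct_homOf _ _ _).trans (fiberSum_eq _ _ _)

lemma homAct_push_of_injective {f : S →[G] T} (hf : Function.Injective f) (φ : invFun S) (s : S) :
    (homAct S T (push f) φ).1 (f s) = φ.1 s := by
  classical
  let _ := Fintype.ofFinite S
  simp [homAct_push, hf.eq_iff]

lemma homAct_push_of_notMem {f : S →[G] T} (φ : invFun S) {t : T} (ht : ∀ s, f s ≠ t) :
    (homAct S T (push f) φ).1 t = 0 := by
  classical
  let _ := Fintype.ofFinite S
  simp [homAct_push, ht]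

/-- A `G`-map factors through an injective `G`-map whose range contains its range. -/
lemma exists_factorization {f : S →[G] U} {j : T →[G] U} (hj : Function.Injective j)
    (h : ∀ s, ∃ t, j t = f s) : ∃ k : S →[G] T, f = j.comp k := by
  choose k hk using h
  exact ⟨⟨k, fun g s => hj (by rw [hk, map_smul, map_smul, hk]; rfl)⟩, by ext s; exact (hk s).symm⟩

lemma map_nsmul_elem (M : Mackey.{w} G) (n : ℕ) (f : S ⟶ T) :
    M.obj.map (n • f) = n • M.obj.map f := M.obj.map_nsmul

variable [Finite G]

/-- The transfer of the constant function `1` along `G / H → G / K` is the index. -/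
lemma homAct_push_orbit {H K : Subgroup G} (f : orbit H →[G] orbit K) :
    homAct _ _ (push f) (oneFun (orbit H)) = (Nat.card K / Nat.card H) • oneFun (orbit K) := by
  classical
  let _ := Fintype.ofFinite (orbit H)
  let _ := Fintype.ofFinite (orbit K)
  set ψ := homAct _ _ (push f) (oneFun (orbit H)) with hψ
  let b : orbit K := QuotientGroup.mk (s := K) 1
  -- An invariant function on a transitive `G`-set is constant, so a single value has to be found.
  have hconst : ∀ t, ψ.1 t = ψ.1 b := by
    rintro ⟨g⟩
    have : (Quot.mk _ g : orbit K) = g • b := by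
      change (QuotientGroup.mk g : G ⧸ K) = QuotientGroup.mk (g * 1)
      rw [mul_one]
    rw [this]
    exact ψ.2 g b
  -- Summation over fibres preserves the total, here that of the constant function `1` on `G/H`.
  -- Dividing by the number of points of `G/K` will give the value.
  have hsum : ∑ t, ψ.1 t = Nat.card (G ⧸ H) := by
    simp only [hψ, homAct_push]
    rw [Finset.sum_comm]
    simp only [Finset.sum_ite_eq, Finset.mem_univ, if_true]
    change ∑ x : orbit H, (1 : ℤ) = _
    rw [Finset.sum_const, Finset.card_univ, nsmul_eq_mul, mul_one, ← Nat.card_eq_fintype_card]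
    rfl
  simp only [hconst] at hsum
  rw [Finset.sum_const, Finset.card_univ, nsmul_eq_mul, ← Nat.card_eq_fintype_card] at hsum
  change ((Nat.card (G ⧸ K) : ℕ) : ℤ) * ψ.1 b = _ at hsum
  have hH := H.card_eq_card_quotient_mul_card_subgroup
  have hK := K.card_eq_card_quotient_mul_card_subgroup
  -- Divisibility makes the natural number quotient `|K| / |H|` exact. Comparing the two expressions
  -- for `|G|` given by Lagrange's theorem identifies `d` with the constant value.
  obtain ⟨d, hd⟩ := card_dvd_card_of_orbitMap f
  have hH0 : 0 < Nat.card H := Nat.card_pos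
  have hK0 : 0 < Nat.card (G ⧸ K) := Nat.card_pos
  have hb : ψ.1 b = d := by
    have h1 : Nat.card (G ⧸ K) * d = Nat.card (G ⧸ H) := by
      apply Nat.eq_of_mul_eq_mul_right hH0
      rw [← hH, hK, hd]
      ring
    rw [← h1] at hsum
    push_cast at hsum
    exact mul_left_cancel₀ (by exact_mod_cast hK0.ne') hsum
  refine invFun_ext fun t => ?_
  rw [hconst, hb, hd, Nat.mul_div_cancel_left _ hH0]
  change (d : ℤ) = d • (1 : ℤ)
  simp

/-! ### Orbit classes and an additive section of the degree -/

/-- The orbits of a finite `G`-set. -/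
abbrev Orbits (S : Burnside G) : Type u := MulAction.orbitRel.Quotient G S

instance (S : Burnside G) : Finite (Orbits S) := Quotient.finite _

instance (S : Burnside G) : Fintype (Orbits S) := Fintype.ofFinite _

/-- The orbit `o` of `S`, as an element of the Burnside ring functor at `S`. -/
def orbitClass (o : Orbits S) : 𝟙_ (Burnside G) ⟶ S := pull (toPoint _) ≫ push (orbitMap o.out)

lemma exists_orbitMap_eq (s : S) (o : Orbits S) (h : (Quotient.mk _ s : Orbits S) = o) :
    ∃ x, orbitMap o.out x = s := by
  obtain ⟨g, hg⟩ := MulAction.orbitRel_apply.1 (Quotient.exact (h.trans o.out_eq.symm))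
  exact ⟨QuotientGroup.mk g, hg⟩

lemma mk_orbitMap (o : Orbits S) (x) : (Quotient.mk _ (orbitMap o.out x) : Orbits S) = o := by
  induction x using QuotientGroup.induction_on with
  | H g =>
    refine Eq.trans (Quotient.sound ?_) o.out_eq
    exact MulAction.orbitRel_apply.2 ⟨g, rfl⟩

open Classical in
-- The domain is the quotient by the full stabilizer, so the map to `S` is injective with image `o`,
-- and each fibre has one point or none. A smaller subgroup would give a multiple of the indicator
-- function.
lemma degree_orbitClass (o : Orbits S) (s : S) :
    (degree S (orbitClass o)).1 s = if (Quotient.mk _ s : Orbits S) = o then 1 else 0 := by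
  rw [orbitClass, degree_comp, degree_toPoint]
  split_ifs with h
  · obtain ⟨x, rfl⟩ := exists_orbitMap_eq s o h
    rw [homAct_push_of_injective (orbitMap_injective _)]
    rfl
  · exact homAct_push_of_notMem _ fun x hx => h (by rw [← hx, mk_orbitMap])

/-- An invariant function as a combination of orbits. -/
def ofFun (S : Burnside G) : invFun S →+ (𝟙_ (Burnside G) ⟶ S) :=
  AddMonoidHom.mk' (fun φ => ∑ o : Orbits S, φ.1 o.out • orbitClass o) fun φ ψ => by
    rw [← Finset.sum_add_distrib]
    exact Finset.sum_congr rfl fun o _ => add_smul _ _ _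

lemma ofFun_apply (φ : invFun S) : ofFun S φ = ∑ o : Orbits S, φ.1 o.out • orbitClass o := rfl

/-- An invariant function is the sum of the indicator functions of the orbits, weighted by its
values at representatives. Hence the degree is surjective, with an additive section. -/
lemma degree_ofFun (φ : invFun S) : degree S (ofFun S φ) = φ := by
  classical
  refine invFun_ext fun s => ?_
  have h : (degree S (ofFun S φ)).1 s =
      ∑ o : Orbits S, φ.1 o.out * (degree S (orbitClass o)).1 s := by
    rw [ofFun_apply, map_sum, AddSubgroup.val_finsetSum, Finset.sum_apply]
    refine Finset.sum_congr rfl fun o _ => ?_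
    rw [map_zsmul]
    rfl
  rw [h]
  simp only [degree_orbitClass, mul_ite, mul_one, mul_zero, Finset.sum_ite_eq, Finset.mem_univ,
    if_true]
  obtain ⟨g, hg⟩ := MulAction.orbitRel_apply.1
    (Quotient.mk_out (s := MulAction.orbitRel G S) s)
  exact (congrArg φ.1 hg.symm).trans (φ.2 g s)

/-- The section recovers orbit classes exactly. For a general class `[G/H → S]` it yields a multiple
of an orbit class instead; the index condition will absorb the difference. -/
lemma ofFun_degree_orbitClass (o : Orbits S) : ofFun S (degree S (orbitClass o)) = orbitClass o := by
  classical
  rw [ofFun_apply, Finset.sum_eq_single o]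
  · rw [degree_orbitClass, if_pos o.out_eq, one_smul]
  · intro o' _ h
    rw [degree_orbitClass, if_neg (by rwa [o'.out_eq]), zero_smul]
  · simp

/-- The image of a transitive `G`-set lies in one orbit, whose inclusion is injective. The factor
`k` is a map between two orbits of the form to which the index condition applies. -/
lemma exists_orbitMap_factorization {H : Subgroup G} (r : orbit H →[G] S) :
    ∃ (o : Orbits S) (k : orbit H →[G] orbit (MulAction.stabilizer G o.out)),
      r = (orbitMap o.out).comp k := by
  refine ⟨Quotient.mk _ (r (QuotientGroup.mk (s := H) 1)), exists_factorization
    (orbitMap_injective _) fun x => exists_orbitMap_eq _ _ ?_⟩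
  induction x using QuotientGroup.induction_on with
  | H g =>
    refine Quotient.sound (MulAction.orbitRel_apply.2 ⟨g, ?_⟩)
    refine (map_smul r g _).symm.trans (congrArg r ?_)
    change (QuotientGroup.mk (g * 1) : G ⧸ H) = _
    rw [mul_one]

/-! ### Mackey functors with the index condition -/

lemma map_pull_push_orbit {M : Mackey.{w} G} (hM : indexCondition.{w} G M) {H K : Subgroup G}
    (f : orbit H →[G] orbit K) :
    M.obj.map (pull f ≫ push f) = (Nat.card K / Nat.card H) • 𝟙 _ := by
  ext x
  rw [← map_comp_elem, hM H K f x]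
  rfl

lemma degree_pull_push {H : Subgroup G} (f : orbit H →[G] S) :
    degree S (pull (toPoint _) ≫ push f) = homAct _ S (push f) (oneFun _) := by
  rw [degree_comp, degree_toPoint]

/-- For a Mackey functor with the index condition, internal multiplication by an element of the
Burnside ring functor depends only on the invariant function that it represents. -/
lemma map_mulEnd_ofFun {M : Mackey.{w} G} (hM : indexCondition.{w} G M) (a : 𝟙_ (Burnside G) ⟶ S) :
    M.obj.map (mulEnd S (ofFun S (degree S a))) = M.obj.map (mulEnd S a) := by
  induction a using hom_induction_orbit with
  | zero => simp only [map_zero]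
  | add a b ha hb => simp only [map_add, Functor.map_add, ha, hb]
  | sub a b ha hb => simp only [map_sub, Functor.map_sub, ha, hb]
  | orbit H l r =>
    -- On a generator `[r]`, write `r = j ∘ k` with `j` the inclusion of the orbit `o`. The same
    -- index `n` then appears twice: as the factor relating the degrees of `[r]` and `[j]`, and as
    -- the scalar by which `k_* k^*` acts.
    obtain ⟨o, k, hk⟩ := exists_orbitMap_factorization r
    have hl : l = toPoint _ := by ext x; rfl
    have h1 : homOf ⟨orbit H, l, r⟩ = pull (toPoint _) ≫ push r := by
      rw [hl, pull_toPoint_push]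
    set n := Nat.card (MulAction.stabilizer G o.out) / Nat.card H with hn
    have h2 : degree S (homOf ⟨orbit H, l, r⟩) = n • degree S (orbitClass o) := by
      rw [h1, degree_pull_push, hk, ← push_comp, homAct_comp, homAct_push_orbit, map_nsmul,
        orbitClass, degree_pull_push]
    -- The left side becomes `n • j_* j^*` and the right side `j_* (k_* k^*) j^*`; the index
    -- condition evaluates the inner pair as `n`.
    rw [h2, map_nsmul, ofFun_degree_orbitClass, map_nsmul, h1, mulEnd_push, orbitClass,
      mulEnd_push, hk, ← pull_comp, ← push_comp, Category.assoc, map_nsmul_elem,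
      ← Category.assoc (pull k), M.obj.map_comp, M.obj.map_comp, M.obj.map_comp,
      map_pull_push_orbit hM]
    simp [hn]

/-- For a Mackey functor with the index condition, external multiplication by an element of the
Burnside ring functor depends only on the invariant function that it represents. -/
lemma map_extEnd_congr {M : Mackey.{w} G} (hM : indexCondition.{w} G M)
    {a b : 𝟙_ (Burnside G) ⟶ S} (h : degree S a = degree S b) (T : Burnside G) :
    M.obj.map (extEnd T a) = M.obj.map (extEnd T b) := by
  -- The degree commutes with restriction along the projection, so the two restricted classes have
  -- the same degree and hence the same image under the section.
  have key : M.obj.map (mulEnd (S ⊗ T) (a ≫ pull (fstMap S T))) =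
      M.obj.map (mulEnd (S ⊗ T) (b ≫ pull (fstMap S T))) := by
    rw [← map_mulEnd_ofFun hM, degree_comp, h, ← degree_comp, map_mulEnd_ofFun hM]
  rw [extEnd_eq, extEnd_eq, M.obj.map_comp, M.obj.map_comp, key]

/-! ### Construction of the module structure -/

/-- Surjectivity of the unit of the constant Green functor. Identities on box products with this
functor can therefore be tested on degrees of morphisms from the point. -/
lemma exists_constEquiv_degree (x : (constFunctor.{w} G).obj S) :
    ∃ a, x = constEquiv S (degree S a) :=
  ⟨ofFun S ((constEquiv S).symm x), by rw [degree_ofFun, AddEquiv.apply_symm_apply]⟩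

/-- The pairing of the constant Green functor with a Mackey functor satisfying the index
condition. -/
def constPairing {M : Mackey.{w} G} (hM : indexCondition.{w} G M) :
    Pairing (constFunctor.{w} G) M.obj M.obj where
  app S T := AddMonoidHom.mk'
    (fun x => (M.obj.map (extEnd T (ofFun S ((constEquiv S).symm x)))).hom)
    fun x y => by rw [map_add, map_add, map_add, M.obj.map_add]; rfl
  natural {S S' T T'} f g x m := by
    change M.obj.map (f ⊗ₘ g) (M.obj.map (extEnd T (ofFun S ((constEquiv S).symm x))) m) =
      M.obj.map (extEnd T' (ofFun S' ((constEquiv S').symm _))) (M.obj.map g m)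
    rw [map_comp_elem, map_comp_elem, extEnd_tensorHom, M.obj.map_comp, M.obj.map_comp]
    -- The section `ofFun` depends on chosen representatives, and the two lifts being compared need
    -- not coincide. They have the same degree, which suffices under the index condition.
    refine congrArg (fun z => (M.obj.map g ≫ z) m) (map_extEnd_congr hM ?_ T')
    obtain ⟨φ, rfl⟩ := (constEquiv S).surjective x
    rw [degree_comp, degree_ofFun, degree_ofFun, constFunctor_map, AddEquiv.symm_apply_apply,
      AddEquiv.symm_apply_apply]

/-- The lift chosen in the definition may be replaced by any class of the same degree; the module
axioms are checked with lifts suited to them. -/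
lemma constPairing_app {M : Mackey.{w} G} (hM : indexCondition.{w} G M) (a : 𝟙_ (Burnside G) ⟶ S)
    (m : M.obj.obj T) : (boxDesc (constPairing hM)).app (S ⊗ T)
      (boxMk _ _ S T (constEquiv S (degree S a)) m) = M.obj.map (extEnd T a) m := by
  refine (boxDesc_boxMk _ _ m).trans ?_
  change M.obj.map (extEnd T (ofFun S ((constEquiv S).symm _))) m = _
  rw [AddEquiv.symm_apply_apply, map_extEnd_congr hM (degree_ofFun _)]

lemma constOne_degree (a : 𝟙_ (Burnside G) ⟶ S) :
    (constOne.{w} G).app S (unitEquiv S a) = constEquiv S (degree S a) := constOne_app a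

lemma constPairing_one {M : Mackey.{w} G} (hM : indexCondition.{w} G M) :
    boxMap (constOne.{w} G) (𝟙 _) ≫ boxDesc (constPairing hM) = boxLeftUnitHom M.obj :=
  box_hom_ext fun S T a m => by
    obtain ⟨a, rfl⟩ := (unitEquiv S).surjective a
    rw [app_comp_elem, boxMap_boxMk, boxLeftUnitHom_boxMk, constOne_degree, app_id_elem,
      constPairing_app, extEnd_apply]

/-- With lifts `a` and `b` of the two functions, multiplicativity of the degree makes `b ≫ extEnd T
a` a lift of their product, and the identity reduces to `extEnd_extEnd`. -/
lemma constPairing_mul {M : Mackey.{w} G} (hM : indexCondition.{w} G M) :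
    boxMap (constMul.{w} G) (𝟙 _) ≫ boxDesc (constPairing hM) =
      boxAssocHom _ _ _ ≫ boxMap (𝟙 _) (boxDesc (constPairing hM)) ≫ boxDesc (constPairing hM) :=
  box_hom_ext₃ fun S T U x y m => by
    obtain ⟨a, rfl⟩ := exists_constEquiv_degree x
    obtain ⟨b, rfl⟩ := exists_constEquiv_degree y
    rw [app_comp_elem, app_comp_elem, app_comp_elem, boxMap_boxMk, constMul_boxMk, app_id_elem,
      ← degree_comp_extEnd, constPairing_app, boxAssocHom_boxMk, app_map_elem, boxMap_boxMk,
      app_map_elem, app_id_elem, constPairing_app, constPairing_app, map_comp_elem,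
      map_comp_elem, extEnd_extEnd]

/-- The module structure over the constant Green functor on a Mackey functor satisfying the index
condition. -/
def constModule {M : Mackey.{w} G} (hM : indexCondition.{w} G M) :
    (constantGreen.{w} G).Modules where
  X := M
  mod :=
    { smul := ObjectProperty.homMk (boxDesc (constPairing hM))
      one_smul := hom_ext' (constPairing_one hM)
      mul_smul := hom_ext' (constPairing_mul hM) }

/-! ### Modules over the constant Green functor -/

/-- The action map of a module over the constant Green functor. -/
def actMap (M : (constantGreen.{w} G).Modules) :
    boxFunctor (constFunctor.{w} G) M.X.obj ⟶ M.X.obj :=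
  (ModObj.smul (M := (constantGreen.{w} G).X) (X := M.X)).hom

lemma constOne_actMap (M : (constantGreen.{w} G).Modules) :
    boxMap (constOne.{w} G) (𝟙 M.X.obj) ≫ actMap M = boxLeftUnitHom M.X.obj :=
  congrArg InducedCategory.Hom.hom
    (ModObj.one_smul (M := (constantGreen.{w} G).X) M.X)

/-- This is the unit axiom evaluated at `a`. Since every invariant function is a degree, the action
is completely determined by the underlying Mackey functor. -/
lemma actMap_boxMk (M : (constantGreen.{w} G).Modules) (a : 𝟙_ (Burnside G) ⟶ S)
    (m : M.X.obj.obj T) : (actMap M).app (S ⊗ T)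
      (boxMk _ _ S T (constEquiv S (degree S a)) m) = M.X.obj.map (extEnd T a) m := by
  have h := congrArg (fun φ => φ.app (S ⊗ T) (boxMk _ _ S T (unitEquiv S a) m)) (constOne_actMap M)
  dsimp only at h
  rwa [app_comp_elem, boxMap_boxMk, boxLeftUnitHom_boxMk, constOne_degree, app_id_elem,
    ← extEnd_apply] at h

/-- Every morphism of Mackey functors between modules over the constant Green functor is a
morphism of modules. -/
lemma actMap_naturality {M N : (constantGreen.{w} G).Modules} (f : M.X ⟶ N.X) :
    actMap M ≫ f.hom = boxMap (𝟙 _) f.hom ≫ actMap N :=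
  box_hom_ext fun S T x m => by
    -- Once `x` is a degree, it acts through a morphism of the Burnside category, with which any
    -- natural transformation commutes.
    obtain ⟨a, rfl⟩ := exists_constEquiv_degree x
    rw [app_comp_elem, app_comp_elem, boxMap_boxMk, actMap_boxMk, app_id_elem, actMap_boxMk,
      app_map_elem]

/-- Two classes at `G/K` are compared: that of `f`, acting by `f_* f^*`, and that of the identity,
acting trivially. The degree of the first is `|K|/|H|` times that of the second, and in a module the
action is additive in the degree. -/
lemma indexCondition_of_module (M : (constantGreen.{w} G).Modules) :
    indexCondition.{w} G M.X := fun H K f x => by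
  -- The right side involves `a` only through its degree.
  have h (a : 𝟙_ (Burnside G) ⟶ orbit K) : M.X.obj.map (mulEnd _ a) x =
      M.X.obj.map (pull (diagMap _)) ((actMap M).app (orbit K ⊗ orbit K)
        (boxMk _ _ _ _ (constEquiv _ (degree _ a)) x)) := by
    rw [mulEnd_apply, M.X.obj.map_comp]
    exact congrArg _ (actMap_boxMk M a x).symm
  have h1 := h (pull (toPoint _) ≫ push f)
  have h2 := h (pull (toPoint _) ≫ push (MulActionHom.id G))
  rw [degree_pull_push, homAct_push_orbit, mulEnd_push] at h1
  rw [degree_comp, degree_toPoint, push_id, homAct_id, ← push_id, mulEnd_push, pull_id, push_id,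
    Category.comp_id, map_id_elem] at h2
  rw [map_comp_elem, h1, map_nsmul, map_nsmul, AddMonoidHom.nsmul_apply, map_nsmul, map_nsmul,
    ← h2]

/-! ### The forgetful functor is an equivalence -/

/-- The forgetful functor from modules over the constant Green functor to Mackey functors with the
index condition. -/
def forgetIndex (G : Type u) [Group G] [Finite G] :
    (constantGreen.{w} G).Modules ⥤ (indexCondition.{w} G).FullSubcategory :=
  (indexCondition.{w} G).lift (Mod.forget _) indexCondition_of_module

instance : (forgetIndex.{w} G).Faithful where
  map_injective h := Mod.hom_ext _ _ (congrArg InducedCategory.Hom.hom h)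

instance : (forgetIndex.{w} G).Full where
  map_surjective f :=
    ⟨Mod.Hom.mk' f.hom (hom_ext' (actMap_naturality f.hom)), rfl⟩

instance : (forgetIndex.{w} G).EssSurj where
  -- The constructed module has `M` itself as its underlying Mackey functor, so the identity serves
  -- as the isomorphism.
  mem_essImage M := ⟨constModule M.property, ⟨Iso.refl _⟩⟩

instance : (forgetIndex.{w} G).IsEquivalence where

end Mackey

end

/-- The equivalence is the forgetful functor with its target restricted to a full subcategory, so
composing with the inclusion gives back the forgetful functor. -/
theorem mainTheorem5 (G : Type u) [Group G] [Finite G] :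
    ∃ e : Mackey.Green.Modules (Mackey.constantGreen.{w} G) ≌
        (Mackey.indexCondition.{w} G).FullSubcategory,
      Nonempty (e.functor ⋙ (Mackey.indexCondition.{w} G).ι ≅ Mod.forget _) :=
  ⟨(Mackey.forgetIndex.{w} G).asEquivalence, ⟨(Mackey.indexCondition.{w} G).liftCompιIso _ _⟩⟩
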